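/- Let $\mathbb G=(\mathbb V,\mathbb E)$ be an infinite, connected, locally finite planar graph drawn in $\mathbb R^2$ such that $0$ is a vertex and the drawing is invariant under translations by $\mathbb Z^2$, under the rotation by $\pi/2$ about $0$, and under the reflections with respect to the $x$ and $y$ axes. For a finite subgraph $G$ of $\mathbb G$ (a finite set $E$ of edges, with vertex set $V$ formed by their endpoints), let $\partial G$ be the set of vertices of $G$ joined to a neighbour by an edge of $\mathbb G$ not in $G$. For $p\in[0,1]$, $q\ge 1$ and boundary conditions $\xi$ (a partition of $\partial G$), let $\phi_G^\xi$ be the random-cluster measure on $\{0,1\}^E$, $$\phi_G^\xi[\omega]=\frac1{Z_G^\xi}\,p^{|\omega|}(1-p)^{|E|-|\omega|}\,q^{k_\xi(\omega)},$$ where $|\omega|$ is the number of open edges and $k_\xi(\omega)$ is the number of connected components of the graph $(V,\omega)$ after identifying vertices in the same class of $\xi$. Write $\phi^0_G$ (free) if no two boundary vertices are wired together, and $\phi^1_G$ (wired) if all of them are. A rectangle $[a,b]\times[c,d]$ is identified with the subgraph formed by the edges having at least one endpoint in it. Let $\Lambda_n=[-n,n]^2$, and let $\mathcal H_{\Lambda_n}$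 be the event that some path of open edges of the subgraph $\Lambda_n$ goes from the left side $\{-n\}\times[-n,n]$ to the right side $\{n\}\times[-n,n]$ (that is, its drawing meets both sides). Let $0\leftrightarrow\partial\Lambda_n$ be the event that $0$ is connected by open edges to $\partial\Lambda_n$, and $0\leftrightarrow\infty$ the event that $0$ belongs to an infinite connected component of open edges. Fix $p\in[0,1]$ and $q\ge1$, and assume (SubCrit): there is $c>0$ such that $\phi^1_{\Lambda_{2n}}[\mathcal H_{\Lambda_n}]\le e^{-cn}$ for every $n\ge1$. Then there exists $c'>0$ such that for every $n\ge 1$, $$\phi^1_{\Lambda_n}[0\leftrightarrow\partial\Lambda_n]\le e^{-c'n}.$$ Moreover, the infinite-volume measures $\phi^0$ and $\phi^1$ on $\{0,1\}^{\mathbb E}$, namely the weak limits of $\phi^0_G$ and $\phi^1_G$ as the finite subgraph $G$ increases to $\mathbb G$, exist, and they satisfy $\phi^1[0\leftrightarrow\infty]=0$ and $\phi^0=\phi^1$. -/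

import Mathlib

open Filter Topology MeasureTheory

/-- An infinite connected locally finite planar graph, drawn in the plane with `0` as a vertex, such
that the drawing is invariant under translations by `ℤ²`, under the rotation by `π/2` about `0` and
under the reflections in the two coordinate axes.  Vertices are points of the plane; as the graph is
connected and infinite, its vertex set is the set of non-isolated points, `graph.support`. -/
structure PlanarLattice where
  /-- the adjacency relation -/
  graph : SimpleGraph (ℝ × ℝ)
  /-- the curve along which an edge is drawn (only meaningful on edges) -/
  arc : Sym2 (ℝ × ℝ) → Set (ℝ × ℝ)
  zero_mem : (0 : ℝ × ℝ) ∈ graph.support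
  connected : ∀ u ∈ graph.support, ∀ v ∈ graph.support, graph.Reachable u v
  finite_vertices : ∀ K : Set (ℝ × ℝ), Bornology.IsBounded K → (K ∩ graph.support).Finite
  finite_degree : ∀ v, (graph.neighborSet v).Finite
  /-- every edge is drawn as a simple arc between its endpoints -/
  arc_simple : ∀ u v, graph.Adj u v →
    ∃ γ : Path u v, Function.Injective γ ∧ arc s(u, v) = Set.range γ
  /-- planarity: distinct edges meet at most at common endpoints (as there are no isolated vertices,
  it follows that an edge does not pass through a vertex other than its endpoints) -/
  arc_inter : ∀ e ∈ graph.edgeSet, ∀ f ∈ graph.edgeSet, e ≠ f →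
    ∀ x ∈ arc e ∩ arc f, x ∈ e ∧ x ∈ f
  adj_translate : ∀ (i j : ℤ) (u v : ℝ × ℝ),
    graph.Adj (u + ((i : ℝ), (j : ℝ))) (v + ((i : ℝ), (j : ℝ))) ↔ graph.Adj u v
  arc_translate : ∀ (i j : ℤ), ∀ e ∈ graph.edgeSet,
    arc (e.map (fun u => u + ((i : ℝ), (j : ℝ)))) = (fun u => u + ((i : ℝ), (j : ℝ))) '' arc e
  adj_rotate : ∀ u v : ℝ × ℝ, graph.Adj (-u.2, u.1) (-v.2, v.1) ↔ graph.Adj u v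
  arc_rotate : ∀ e ∈ graph.edgeSet,
    arc (e.map (fun u => (-u.2, u.1))) = (fun u : ℝ × ℝ => (-u.2, u.1)) '' arc e
  adj_reflect_x : ∀ u v : ℝ × ℝ, graph.Adj (u.1, -u.2) (v.1, -v.2) ↔ graph.Adj u v
  arc_reflect_x : ∀ e ∈ graph.edgeSet,
    arc (e.map (fun u => (u.1, -u.2))) = (fun u : ℝ × ℝ => (u.1, -u.2)) '' arc e
  adj_reflect_y : ∀ u v : ℝ × ℝ, graph.Adj (-u.1, u.2) (-v.1, v.2) ↔ graph.Adj u v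
  arc_reflect_y : ∀ e ∈ graph.edgeSet,
    arc (e.map (fun u => (-u.1, u.2))) = (fun u : ℝ × ℝ => (-u.1, u.2)) '' arc e

namespace PlanarLattice

variable (L : PlanarLattice)

/-- The edges of the lattice. -/
abbrev Edge : Type := L.graph.edgeSet

/-- A percolation configuration, given by its set of open edges.  The σ-algebra is Mathlib's on
`Set`, which is the product σ-algebra of `{0,1}^𝔼`. -/
abbrev Config : Type := Set L.Edge

variable {L}

/-- The graph formed by the open edges of a configuration. -/
def openGraph (ω : L.Config) : SimpleGraph (ℝ × ℝ) :=
  SimpleGraph.fromEdgeSet (Subtype.val '' ω)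

/-- The vertices of the finite subgraph with edge set `E`. -/
def vertices (E : Finset L.Edge) : Set (ℝ × ℝ) :=
  {v | ∃ e ∈ E, v ∈ (e : Sym2 (ℝ × ℝ))}

/-- The boundary of the finite subgraph with edge set `E`: its vertices that are joined to a
neighbour by an edge of the lattice which is outside the subgraph. -/
def boundary (E : Finset L.Edge) : Set (ℝ × ℝ) :=
  {v | v ∈ vertices E ∧ ∃ e : L.Edge, e ∉ E ∧ v ∈ (e : Sym2 (ℝ × ℝ))}

/-- Boundary conditions: a partition of the boundary. -/
abbrev BoundaryCondition (E : Finset L.Edge) : Type := Setoid (boundary E)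

/-- Free boundary conditions: no two boundary vertices are wired together. -/
abbrev free (E : Finset L.Edge) : BoundaryCondition E := ⊥

/-- Wired boundary conditions: all boundary vertices are wired together. -/
abbrev wired (E : Finset L.Edge) : BoundaryCondition E := ⊤

/-- The open edges of `ω`, with in addition an edge between any two vertices wired together by
`ξ`; its components are those of the graph obtained from `ω` by identifying wired vertices. -/
def wiredGraph {E : Finset L.Edge} (ξ : BoundaryCondition E) (ω : L.Config) :
    SimpleGraph (ℝ × ℝ) :=
  openGraph ω ⊔ SimpleGraph.fromRel
    (fun u v => ∃ (hu : u ∈ boundary E) (hv : v ∈ boundary E), ξ ⟨u, hu⟩ ⟨v, hv⟩)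

/-- The number `k_ξ(ω)` of clusters, counted on the vertices of the subgraph. -/
noncomputable def numClusters {E : Finset L.Edge} (ξ : BoundaryCondition E) (ω : L.Config) : ℕ :=
  Nat.card ((wiredGraph ξ ω).induce (vertices E)).ConnectedComponent

/-- The weight `p^{#open} (1-p)^{#closed} q^{k_ξ(ω)}` of a configuration `ω ⊆ E`.  Up to the factor
`(1-p)^{#E}` this is `(p/(1-p))^{#open} q^{k_ξ(ω)}`, and it makes sense for `p = 1`. -/
noncomputable def weight {E : Finset L.Edge} (ξ : BoundaryCondition E) (p q : ℝ)
    (ω : Finset L.Edge) : ℝ :=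
  p ^ ω.card * (1 - p) ^ (E.card - ω.card) * q ^ numClusters ξ (ω : Set L.Edge)

open scoped Classical in
/-- The probability of the event `A` under the random-cluster measure on the finite subgraph with
edge set `E`, with boundary conditions `ξ`. -/
noncomputable def rcProb {E : Finset L.Edge} (ξ : BoundaryCondition E) (p q : ℝ)
    (A : Set L.Config) : ℝ :=
  (∑ ω ∈ E.powerset with ((ω : Finset L.Edge) : Set L.Edge) ∈ A, weight ξ p q ω) /
    ∑ ω ∈ E.powerset, weight ξ p q ω

/-- The subgraph (as a set of edges) identified with the rectangle `[a,b] × [c,d]`: the edges with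
at least one endpoint in the rectangle. -/
def rectEdges (L : PlanarLattice) (a b c d : ℝ) : Set L.Edge :=
  {e | ∃ v ∈ (e : Sym2 (ℝ × ℝ)), v ∈ Set.Icc a b ×ˢ Set.Icc c d}

theorem finite_rectEdges (L : PlanarLattice) (a b c d : ℝ) : (L.rectEdges a b c d).Finite := by
  have h1 : (Set.Icc a b ×ˢ Set.Icc c d ∩ L.graph.support).Finite :=
    L.finite_vertices _ ((Metric.isBounded_Icc a b).prod (Metric.isBounded_Icc c d))
  have h2 : (⋃ v ∈ Set.Icc a b ×ˢ Set.Icc c d ∩ L.graph.support,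
      (fun w => s(v, w)) '' L.graph.neighborSet v).Finite :=
    h1.biUnion fun v _ => (L.finite_degree v).image _
  refine Set.Finite.of_finite_image (f := Subtype.val) (h2.subset ?_)
    Subtype.val_injective.injOn
  rintro _ ⟨⟨e, he⟩, ⟨v, hve, hv⟩, rfl⟩
  obtain ⟨w, rfl⟩ := Sym2.mem_iff_exists.1 hve
  have hadj : L.graph.Adj v w := he
  exact Set.mem_biUnion (x := v) ⟨hv, w, hadj⟩ ⟨w, hadj, rfl⟩

/-- The box `Λ_n = [-n,n]²`, as a finite subgraph. -/
noncomputable def box (L : PlanarLattice) (n : ℕ) : Finset L.Edge :=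
  (L.finite_rectEdges (-n) n (-n) n).toFinset

/-- The event that `[a,b] × [c,d]` is crossed horizontally: some path of open edges of the subgraph
`[a,b] × [c,d]` goes from the left side to the right side, that is, the drawing of the path meets
both sides. -/
def horizontalCrossing (L : PlanarLattice) (a b c d : ℝ) : Set L.Config :=
  {ω | ∃ (u v : ℝ × ℝ) (w : (openGraph (ω ∩ L.rectEdges a b c d)).Walk u v),
    (∃ e ∈ w.edges, (L.arc e ∩ {a} ×ˢ Set.Icc c d).Nonempty) ∧
    (∃ e ∈ w.edges, (L.arc e ∩ {b} ×ˢ Set.Icc c d).Nonempty)}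

/-- The event that `0` is connected by open edges to the boundary of the subgraph `E`. -/
def zeroToBoundary (E : Finset L.Edge) : Set L.Config :=
  {ω | ∃ v ∈ boundary E, (openGraph ω).Reachable 0 v}

/-- The event that `0` belongs to an infinite connected component. -/
def zeroToInfinity (L : PlanarLattice) : Set L.Config :=
  {ω | {v | (openGraph ω).Reachable 0 v}.Infinite}

/-- `A` depends only on the states of the edges in `F`. -/
def DependsOnEdges (A : Set L.Config) (F : Finset L.Edge) : Prop :=
  ∀ ω ω' : L.Config, (∀ e ∈ F, e ∈ ω ↔ e ∈ ω') → (ω ∈ A ↔ ω' ∈ A)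

/-- `φ` is the weak limit, as the finite subgraph `E` increases to the whole lattice, of the
random-cluster measures on `E` with boundary conditions `bc E`: the probabilities of all events
depending on finitely many edges converge.  There is at most one such `φ`. -/
def IsInfiniteVolumeMeasure (bc : ∀ E : Finset L.Edge, BoundaryCondition E) (p q : ℝ)
    (φ : Measure L.Config) : Prop :=
  IsProbabilityMeasure φ ∧ ∀ (F : Finset L.Edge) (A : Set L.Config), DependsOnEdges A F →
    Tendsto (fun E : Finset L.Edge => rcProb (bc E) p q A) atTop (𝓝 (φ.real A))

/-- The subcritical property: the probability, with wired boundary conditions on `Λ_{2n}`, that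
`Λ_n` is crossed horizontally decays exponentially fast. -/
def SubCrit (L : PlanarLattice) (p q : ℝ) : Prop :=
  ∃ c : ℝ, 0 < c ∧ ∀ n : ℕ, 1 ≤ n →
    rcProb (wired (L.box (2 * n))) p q (L.horizontalCrossing (-n) n (-n) n) ≤ Real.exp (-(c * n))

end PlanarLattice

/-! A long arm from `0` forces a crossing of a square of comparable size. Stop an open path from `0`
to the boundary of `Λ_n` when it leaves `Λ_k`, with `k` about `n / 8`. The longer side of its
bounding rectangle exceeds `k`, so up to a rotation the path joins vertices near the two vertical
sides of a square with integer centre and half-side `m`, where `m ≤ n ≤ 20 m`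
(`exists_crossing_of_toBoundary`). Opening a bounded number of edges near these sides, at the cost
of a constant factor, produces a genuine crossing (`exists_extension`, `pow_mul_rcProb_le`). The
square with twice the side still lies in `Λ_n`, so monotonicity in the domain and invariance under
translations and rotation reduce to (SubCrit). A union bound over the polynomially many squares and
endpoints gives `n ^ 7 * exp (-c n / 20)` up to a constant (`exists_polynomial_bound`). Half of the
rate absorbs the polynomial. The finitely many small `n` only need probabilities below `1`, and
these hold because (SubCrit) excludes `p = 1`.

The comparison inequalities used here (positive association, free below wired, monotonicity in the
domain) all follow from the four functions theorem. Its lattice condition is the supermodularity of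
the number of components (`ncc_add_le`), which is the dimension formula applied to spaces of locally
constant functions.

In infinite volume, the probability that given edges are open is monotone in the domain, hence
converges; inclusion-exclusion and compactness then give `φ⁰` and `φ¹`. The decay passes to the
limit and excludes an infinite cluster at `0`. For `φ⁰ = φ¹`, explore the cluster of the wired
boundary: if it misses a finite set of edges, the unexplored region containing this set carries a
free measure, which is dominated by the free measure of the whole box
(`rcProb_wired_inter_notToBoundary_le`). The boundary cluster reaches a fixed vertex with vanishing
probability, so wired is asymptotically at most free. -/

namespace SimpleGraph

/-! ### Counting connected components by linear algebra. -/

variable {X : Type*}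

/-- Functions supported on `V` that are constant along the edges of `G` inside `V`. -/
def locConst (V : Set X) (G : SimpleGraph X) : Submodule ℚ (X → ℚ) where
  carrier := {f | (∀ x ∉ V, f x = 0) ∧ ∀ u ∈ V, ∀ v ∈ V, G.Adj u v → f u = f v}
  add_mem' := by
    rintro f g ⟨hf, hf'⟩ ⟨hg, hg'⟩
    exact ⟨fun x hx => by simp [hf x hx, hg x hx],
      fun u hu v hv h => by simp [hf' u hu v hv h, hg' u hu v hv h]⟩
  zero_mem' := by simp
  smul_mem' := by
    rintro c f ⟨hf, hf'⟩
    exact ⟨fun x hx => by simp [hf x hx], fun u hu v hv h => by simp [hf' u hu v hv h]⟩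

theorem locConst_reachable {V : Set X} {G : SimpleGraph X} {f : X → ℚ} (hf : f ∈ locConst V G)
    {u v : V} (h : (G.induce V).Reachable u v) : f u = f v := by
  obtain ⟨w⟩ := h
  induction w with
  | nil => rfl
  | cons h _ ih => exact (hf.2 _ (Subtype.coe_prop _) _ (Subtype.coe_prop _) h).trans ih

open scoped Classical in
/-- Locally constant functions are functions on the set of components. -/
noncomputable def locConstEquiv (V : Set X) (G : SimpleGraph X) :
    locConst V G ≃ₗ[ℚ] ((G.induce V).ConnectedComponent → ℚ) where
  toFun f := ConnectedComponent.lift (fun v => f.1 v)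
    (fun _ _ w _ => locConst_reachable f.2 w.reachable)
  map_add' f g := by
    ext c
    induction c using ConnectedComponent.ind
    rfl
  map_smul' a f := by
    ext c
    induction c using ConnectedComponent.ind
    rfl
  invFun g := ⟨fun x => if h : x ∈ V then g ((G.induce V).connectedComponentMk ⟨x, h⟩) else 0,
    fun x hx => by simp [hx], fun u hu v hv h => by
      simp only [hu, hv, dif_pos]
      congr 1
      exact ConnectedComponent.sound (Adj.reachable (G := G.induce V) (u := ⟨u, hu⟩) (v := ⟨v, hv⟩) h)⟩
  left_inv f := by
    ext x
    by_cases hx : x ∈ V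
    · simp [hx]
    · simp [hx, f.2.1 x hx]
  right_inv g := by
    ext c
    induction c using ConnectedComponent.ind with
    | h v => simp

/-- The number of components of the subgraph induced on `V`. -/
noncomputable def ncc (V : Set X) (G : SimpleGraph X) : ℕ :=
  Nat.card (G.induce V).ConnectedComponent

theorem finite_components {V : Set X} (hV : V.Finite) (G : SimpleGraph X) :
    Finite (G.induce V).ConnectedComponent := by
  have := hV.to_subtype
  exact Finite.of_surjective (G.induce V).connectedComponentMk Quot.mk_surjective

theorem finiteDimensional_locConst {V : Set X} (hV : V.Finite) (G : SimpleGraph X) :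
    FiniteDimensional ℚ (locConst V G) := by
  have := finite_components hV G
  exact (locConstEquiv V G).symm.finiteDimensional

/-- Turns counting into dimensions: taking the union of two graphs amounts to intersecting their
spaces of locally constant functions. -/
theorem ncc_eq_finrank {V : Set X} (hV : V.Finite) (G : SimpleGraph X) :
    ncc V G = Module.finrank ℚ (locConst V G) := by
  have := finite_components hV G
  have := Fintype.ofFinite (G.induce V).ConnectedComponent
  rw [(locConstEquiv V G).finrank_eq, Module.finrank_fintype_fun_eq_card, ncc,
    Nat.card_eq_fintype_card]

theorem ncc_congr {V : Set X} {G H : SimpleGraph X}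
    (h : ∀ u ∈ V, ∀ v ∈ V, G.Adj u v ↔ H.Adj u v) : ncc V G = ncc V H := by
  have : G.induce V = H.induce V := by
    ext u v
    exact h u u.2 v v.2
  rw [ncc, ncc, this]

/-- The number of components is supermodular and antitone. -/
theorem ncc_add_le {V : Set X} (hV : V.Finite) {G H K J : SimpleGraph X}
    (hK : ∀ u ∈ V, ∀ v ∈ V, K.Adj u v → G.Adj u v ∧ H.Adj u v)
    (hJ : ∀ u ∈ V, ∀ v ∈ V, J.Adj u v → G.Adj u v ∨ H.Adj u v) :
    ncc V G + ncc V H ≤ ncc V K + ncc V J := by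
  simp only [ncc_eq_finrank hV]
  have := finiteDimensional_locConst hV G
  have := finiteDimensional_locConst hV H
  have := finiteDimensional_locConst hV K
  have := finiteDimensional_locConst hV J
  -- The sum of the two spaces lies in that of `K`, whose edges belong to both graphs; their
  -- intersection lies in that of `J`, each of whose edges belongs to one of them.
  rw [← Submodule.finrank_sup_add_finrank_inf_eq]
  refine add_le_add (Submodule.finrank_mono (sup_le ?_ ?_)) (Submodule.finrank_mono ?_)
  · exact fun f hf => ⟨hf.1, fun u hu v hv h => hf.2 u hu v hv (hK u hu v hv h).1⟩
  · exact fun f hf => ⟨hf.1, fun u hu v hv h => hf.2 u hu v hv (hK u hu v hv h).2⟩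
  · rintro f ⟨hf, hf'⟩
    exact ⟨hf.1, fun u hu v hv h => (hJ u hu v hv h).elim (hf.2 u hu v hv) (hf'.2 u hu v hv)⟩

/-- A locally constant function on `V ∪ W` is uniquely the sum of its restrictions to `V` and `W`,
so the dimensions add. -/
theorem ncc_union {V W : Set X} (hV : V.Finite) (hW : W.Finite) (hVW : Disjoint V W)
    {G : SimpleGraph X} (hG : ∀ u ∈ V, ∀ v ∈ W, ¬ G.Adj u v) :
    ncc (V ∪ W) G = ncc V G + ncc W G := by
  classical
  simp only [ncc_eq_finrank hV, ncc_eq_finrank hW, ncc_eq_finrank (hV.union hW)]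
  have := finiteDimensional_locConst hV G
  have := finiteDimensional_locConst hW G
  rw [← Submodule.finrank_sup_add_finrank_inf_eq]
  have h1 : locConst V G ⊓ locConst W G = ⊥ := by
    rw [eq_bot_iff]
    rintro f ⟨hf, hf'⟩
    ext x
    by_cases hx : x ∈ V
    · exact hf'.1 x (Set.disjoint_left.1 hVW hx)
    · exact hf.1 x hx
  have h2 : locConst V G ⊔ locConst W G = locConst (V ∪ W) G := by
    apply le_antisymm
    · refine sup_le ?_ ?_
      · intro f hf
        refine ⟨fun x hx => hf.1 x fun h => hx (Or.inl h), ?_⟩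
        rintro u (hu | hu) v (hv | hv) h
        · exact hf.2 u hu v hv h
        · exact (hG u hu v hv h).elim
        · exact (hG v hv u hu h.symm).elim
        · rw [hf.1 u (Set.disjoint_right.1 hVW hu), hf.1 v (Set.disjoint_right.1 hVW hv)]
      · intro f hf
        refine ⟨fun x hx => hf.1 x fun h => hx (Or.inr h), ?_⟩
        rintro u (hu | hu) v (hv | hv) h
        · rw [hf.1 u (Set.disjoint_left.1 hVW hu), hf.1 v (Set.disjoint_left.1 hVW hv)]
        · exact (hG u hu v hv h).elim
        · exact (hG v hv u hu h.symm).elim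
        · exact hf.2 u hu v hv h
    · intro f hf
      have : f = V.indicator f + W.indicator f := by
        ext x
        by_cases hx : x ∈ V
        · simp [hx, Set.disjoint_left.1 hVW hx]
        · by_cases hx' : x ∈ W
          · simp [hx, hx']
          · simp [hx, hx', hf.1 x (by simp [hx, hx'])]
      rw [this]
      refine Submodule.add_mem_sup ⟨fun x hx => by simp [hx], fun u hu v hv h => ?_⟩
        ⟨fun x hx => by simp [hx], fun u hu v hv h => ?_⟩
      · simpa [hu, hv] using hf.2 u (Or.inl hu) v (Or.inl hv) h
      · simpa [hu, hv] using hf.2 u (Or.inr hu) v (Or.inr hv) h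
  rw [h1, h2, finrank_bot, add_zero]

/-- The complete graph on a set of vertices. -/
def completeOn (B : Set X) : SimpleGraph X where
  Adj u v := u ≠ v ∧ u ∈ B ∧ v ∈ B
  symm := ⟨fun _ _ h => ⟨h.1.symm, h.2.2, h.2.1⟩⟩
  loopless := ⟨fun _ h => h.1 rfl⟩

@[simp] theorem completeOn_adj {B : Set X} {u v : X} :
    (completeOn B).Adj u v ↔ u ≠ v ∧ u ∈ B ∧ v ∈ B := Iff.rfl

/-- Adding vertices that are wired to a nonempty boundary does not change the number of
components. -/
theorem ncc_sup_completeOn {V W B : Set X} (hV : V.Finite) (hW : W.Finite) (hVW : V ⊆ W)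
    (hB : B.Nonempty) (hBV : B ⊆ V) {G : SimpleGraph X}
    (hG : ∀ u v, G.Adj u v → u ∈ V ∧ v ∈ V) :
    ncc V (G ⊔ completeOn B) = ncc W (G ⊔ completeOn (W \ V ∪ B)) := by
  classical
  simp only [ncc_eq_finrank hV, ncc_eq_finrank hW]
  obtain ⟨b, hb⟩ := hB
  -- Restriction to `V`. It is bijective because the values on `W \ V` are forced to equal the value
  -- at the boundary point `b`.
  let φ : locConst W (G ⊔ completeOn (W \ V ∪ B)) →ₗ[ℚ] locConst V (G ⊔ completeOn B) :=
    { toFun := fun f => ⟨V.indicator f.1, fun x hx => by simp [hx], fun u hu v hv h => by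
        have := f.2.2 u (hVW hu) v (hVW hv) (h.imp id (fun h => ⟨h.1, Or.inr h.2.1, Or.inr h.2.2⟩))
        simpa [hu, hv] using this⟩
      map_add' := fun f g => Subtype.ext (Set.indicator_add V f.1 g.1)
      map_smul' := fun a f => Subtype.ext (Set.indicator_const_smul V a f.1) }
  have hval : ∀ f ∈ locConst W (G ⊔ completeOn (W \ V ∪ B)), ∀ x ∈ W \ V, f x = f b := by
    intro f hf x hx
    exact hf.2 x hx.1 b (hVW (hBV hb))
      (Or.inr ⟨fun h => hx.2 (h ▸ hBV hb), Or.inl hx, Or.inr hb⟩)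
  refine (LinearEquiv.ofBijective φ ⟨?_, ?_⟩).finrank_eq.symm
  · rw [← LinearMap.ker_eq_bot, LinearMap.ker_eq_bot']
    intro f hf
    have h0 : ∀ x ∈ V, f.1 x = 0 := fun x hx => by
      have := congrFun (congrArg Subtype.val hf) x
      simpa [φ, hx] using this
    ext x
    by_cases hx : x ∈ V
    · exact h0 x hx
    · by_cases hx' : x ∈ W
      · exact (hval f.1 f.2 x ⟨hx', hx⟩).trans (h0 b (hBV hb))
      · exact f.2.1 x hx'
  · intro g
    have hgB : ∀ x ∈ B, g.1 x = g.1 b := fun x hx => by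
      by_cases h : x = b
      · rw [h]
      · exact g.2.2 x (hBV hx) b (hBV hb) (Or.inr ⟨h, hx, hb⟩)
    refine ⟨⟨fun x => if x ∈ V then g.1 x else if x ∈ W then g.1 b else 0,
      fun x hx => by simp [hx, mt (@hVW x) hx], ?_⟩, ?_⟩
    · intro u hu v hv h
      have key : ∀ x ∈ W \ V ∪ B, (if x ∈ V then g.1 x else if x ∈ W then g.1 b else 0) = g.1 b := by
        rintro x (hx | hx)
        · simp [hx.1, hx.2]
        · simp [hBV hx, hgB x hx]
      rcases h with h | h
      · obtain ⟨h1, h2⟩ := hG u v h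
        simpa [h1, h2] using g.2.2 u h1 v h2 (Or.inl h)
      · exact (key u h.2.1).trans (key v h.2.2).symm
    · ext x
      by_cases hx : x ∈ V
      · simp [φ, hx]
      · simp [φ, hx, g.2.1 x hx]

end SimpleGraph

/-! ### Weighted sums over configurations and the four functions theorem. -/

open scoped Classical in
/-- The total weight of the subsets of `U` in the event `A`. -/
noncomputable def wsum {α : Type*} (U : Finset α) (μ : Finset α → ℝ) (A : Set (Set α)) : ℝ :=
  ∑ ω ∈ U.powerset with ((ω : Finset α) : Set α) ∈ A, μ ω

open scoped Classical in
theorem wsum_eq_sum_ite {α : Type*} (U : Finset α) (μ : Finset α → ℝ) (A : Set (Set α)) :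
    wsum U μ A = ∑ ω ∈ U.powerset, if (ω : Set α) ∈ A then μ ω else 0 :=
  Finset.sum_filter _ _

theorem wsum_univ {α : Type*} (U : Finset α) (μ : Finset α → ℝ) :
    wsum U μ Set.univ = ∑ ω ∈ U.powerset, μ ω := by
  simp [wsum]

/-- The four functions theorem for increasing events. -/
theorem wsum_mul_wsum_le {α : Type*} [DecidableEq α] {U : Finset α} {μ ν : Finset α → ℝ} (hμ : ∀ a, 0 ≤ μ a)
    (hν : ∀ a, 0 ≤ ν a)
    (h : ∀ a ⊆ U, ∀ b ⊆ U, μ a * ν b ≤ μ (a ∩ b) * ν (a ∪ b)) {A B : Set (Set α)}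
    (hA : IsUpperSet A) (hB : IsUpperSet B) :
    wsum U μ A * wsum U ν B ≤ wsum U μ Set.univ * wsum U ν (A ∩ B) := by
  classical
  -- The third function carries no indicator, since `a ∩ b` need not lie in either event; the union
  -- lies in both, as they are increasing.
  have key := Finset.four_functions_theorem U
    (f₁ := fun a => if (a : Set α) ∈ A then μ a else 0)
    (f₂ := fun a => if (a : Set α) ∈ B then ν a else 0) (f₃ := μ)
    (f₄ := fun a => if (a : Set α) ∈ A ∩ B then ν a else 0)
    (fun a => by dsimp; split_ifs <;> simp [hμ]) (fun a => by dsimp; split_ifs <;> simp [hν])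
    hμ (fun a => by dsimp; split_ifs <;> simp [hν]) ?_ (subset_refl U.powerset)
    (subset_refl U.powerset)
  · rw [wsum_univ]
    simp only [wsum_eq_sum_ite]
    simp only [Finset.powerset_infs_powerset_self, Finset.powerset_sups_powerset_self] at key
    refine (le_of_eq ?_).trans (key.trans (le_of_eq ?_)) <;> congr!
  · intro s hs t ht
    by_cases h1 : (s : Set α) ∈ A
    · by_cases h2 : (t : Set α) ∈ B
      · have h3 : ((s ∪ t : Finset α) : Set α) ∈ A ∩ B := by
          rw [Finset.coe_union]
          exact ⟨hA Set.subset_union_left h1, hB Set.subset_union_right h2⟩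
        rw [if_pos h1, if_pos h2, if_pos h3]
        exact h s hs t ht
      · rw [if_neg h2, mul_zero]
        refine mul_nonneg (hμ _) ?_
        split_ifs <;> simp [hν]
    · rw [if_neg h1, zero_mul]
      refine mul_nonneg (hμ _) ?_
      split_ifs <;> simp [hν]

/-! ### Finite-volume measures: positive association and comparison of domains. -/

namespace PlanarLattice

variable {L : PlanarLattice}

theorem openGraph_adj {ω : L.Config} {u v : ℝ × ℝ} :
    (openGraph ω).Adj u v ↔ ∃ e ∈ ω, (e : Sym2 (ℝ × ℝ)) = s(u, v) := by
  rw [openGraph, SimpleGraph.fromEdgeSet_adj]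
  constructor
  · rintro ⟨⟨e, he, h⟩, -⟩
    exact ⟨e, he, h⟩
  · rintro ⟨e, he, h⟩
    refine ⟨⟨e, he, h⟩, ?_⟩
    have := e.2
    rw [h, SimpleGraph.mem_edgeSet] at this
    exact this.ne

theorem openGraph_mono {ω ω' : L.Config} (h : ω ⊆ ω') : openGraph ω ≤ openGraph ω' := by
  intro u v huv
  rw [openGraph_adj] at huv ⊢
  obtain ⟨e, he, h'⟩ := huv
  exact ⟨e, h he, h'⟩

theorem finite_vertices_finset (E : Finset L.Edge) : (vertices E).Finite := by
  have : vertices E = ⋃ e ∈ E, {v | v ∈ (e : Sym2 (ℝ × ℝ))} := by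
    ext v
    simp [vertices]
  rw [this]
  refine E.finite_toSet.biUnion fun e _ => ?_
  induction (e : Sym2 (ℝ × ℝ)) using Sym2.ind with
  | h x y =>
    refine (Set.toFinite {x, y}).subset fun v hv => ?_
    simpa using hv

theorem boundary_subset (E : Finset L.Edge) : boundary E ⊆ vertices E := fun _ h => h.1

theorem openGraph_adj_vertices {E : Finset L.Edge} {ω : L.Config} (h : ω ⊆ E) {u v : ℝ × ℝ}
    (huv : (openGraph ω).Adj u v) : u ∈ vertices E ∧ v ∈ vertices E := by
  obtain ⟨e, he, h'⟩ := openGraph_adj.1 huv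
  exact ⟨⟨e, h he, by simp [h']⟩, ⟨e, h he, by simp [h']⟩⟩

theorem mem_support_of_mem {e : L.Edge} {v : ℝ × ℝ} (h : v ∈ (e : Sym2 (ℝ × ℝ))) :
    v ∈ L.graph.support := by
  obtain ⟨w, hw⟩ := Sym2.mem_iff_exists.1 h
  have := e.2
  rw [hw, SimpleGraph.mem_edgeSet] at this
  exact ⟨w, this⟩

theorem mem_support_translate (i j : ℤ) {u : ℝ × ℝ} :
    u + ((i : ℝ), (j : ℝ)) ∈ L.graph.support ↔ u ∈ L.graph.support := by
  simp only [SimpleGraph.mem_support]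
  constructor
  · rintro ⟨w, hw⟩
    refine ⟨w - ((i : ℝ), (j : ℝ)), ?_⟩
    rw [← L.adj_translate i j]
    simpa using hw
  · rintro ⟨w, hw⟩
    exact ⟨w + ((i : ℝ), (j : ℝ)), (L.adj_translate i j u w).2 hw⟩

theorem intCast_mem_support (i j : ℤ) : ((i : ℝ), (j : ℝ)) ∈ L.graph.support := by
  have := (mem_support_translate (L := L) i j (u := 0)).2 L.zero_mem
  simpa using this

theorem infinite_support (L : PlanarLattice) : L.graph.support.Infinite := by
  refine Set.infinite_of_injective_forall_mem (f := fun i : ℤ => ((i : ℝ), ((0 : ℤ) : ℝ)))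
    (fun i j h => ?_) (fun i => intCast_mem_support i 0)
  simpa using h

/-- With an empty boundary, paths could never leave `E`, so connectedness would put the infinitely
many vertices of the lattice in a finite set. `ncc_sup_completeOn` needs such a boundary point to
glue the exterior to. -/
theorem boundary_nonempty {E : Finset L.Edge} (hE : E.Nonempty) : (boundary E).Nonempty := by
  by_contra hne
  rw [Set.not_nonempty_iff_eq_empty] at hne
  obtain ⟨e, he⟩ := hE
  obtain ⟨v, hv⟩ : ∃ v, v ∈ (e : Sym2 (ℝ × ℝ)) := ⟨_, Sym2.out_fst_mem _⟩
  refine (infinite_support L) ((finite_vertices_finset E).subset fun w hw => ?_)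
  obtain ⟨p⟩ := L.connected v (mem_support_of_mem hv) w hw
  have hv' : v ∈ vertices E := ⟨e, he, hv⟩
  clear hv hw
  induction p with
  | nil => exact hv'
  | @cons a b c h _ ih =>
    apply ih
    by_cases hE : (⟨s(a, b), h⟩ : L.Edge) ∈ E
    · exact ⟨_, hE, by simp⟩
    · have : a ∈ boundary E := ⟨hv', ⟨s(a, b), h⟩, hE, by simp⟩
      simp [hne] at this

theorem wiredGraph_wired (E : Finset L.Edge) (ω : L.Config) :
    wiredGraph (wired E) ω = openGraph ω ⊔ SimpleGraph.completeOn (boundary E) := by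
  rw [wiredGraph]
  congr 1
  ext u v
  simp only [SimpleGraph.fromRel_adj, SimpleGraph.completeOn_adj]
  refine and_congr_right fun _ => ?_
  constructor
  · rintro (⟨h, h', -⟩ | ⟨h, h', -⟩)
    exacts [⟨h, h'⟩, ⟨h', h⟩]
  · exact fun h => Or.inl ⟨h.1, h.2, trivial⟩

theorem wiredGraph_free (E : Finset L.Edge) (ω : L.Config) :
    wiredGraph (free E) ω = openGraph ω := by
  rw [wiredGraph, sup_eq_left]
  intro u v h
  rw [SimpleGraph.fromRel_adj] at h
  obtain ⟨h, (⟨_, _, h'⟩ | ⟨_, _, h'⟩)⟩ := h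
  · exact (h (congrArg Subtype.val h')).elim
  · exact (h (congrArg Subtype.val h').symm).elim

theorem numClusters_wired (E : Finset L.Edge) (ω : L.Config) :
    numClusters (wired E) ω =
      SimpleGraph.ncc (vertices E) (openGraph ω ⊔ SimpleGraph.completeOn (boundary E)) := by
  rw [numClusters, wiredGraph_wired, SimpleGraph.ncc]

theorem numClusters_free (E : Finset L.Edge) (ω : L.Config) :
    numClusters (free E) ω = SimpleGraph.ncc (vertices E) (openGraph ω) := by
  rw [numClusters, wiredGraph_free, SimpleGraph.ncc]

section weights

variable {p q : ℝ}

theorem weight_nonneg (hp : p ∈ Set.Icc (0 : ℝ) 1) (hq : 1 ≤ q) {E : Finset L.Edge}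
    (ξ : BoundaryCondition E) (ω : Finset L.Edge) : 0 ≤ weight ξ p q ω := by
  have := hp.1
  have : 0 ≤ 1 - p := sub_nonneg.2 hp.2
  unfold weight
  positivity

/-- When the edge counts balance, the powers of `p` and `1 - p` agree on both sides, and `q ≥ 1`
leaves only a comparison of cluster numbers. Two domains are allowed so as to compare measures on
different subgraphs. -/
theorem weight_mul_le (hp : p ∈ Set.Icc (0 : ℝ) 1) (hq : 1 ≤ q) {E E' : Finset L.Edge}
    {ξ : BoundaryCondition E} {ξ' : BoundaryCondition E'} {a b c d : Finset L.Edge}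
    (ha : a ⊆ E) (hb : b ⊆ E') (hc : c ⊆ E) (hd : d ⊆ E')
    (hcard : a.card + b.card = c.card + d.card)
    (hk : numClusters ξ (a : Set L.Edge) + numClusters ξ' (b : Set L.Edge) ≤
      numClusters ξ (c : Set L.Edge) + numClusters ξ' (d : Set L.Edge)) :
    weight ξ p q a * weight ξ' p q b ≤ weight ξ p q c * weight ξ' p q d := by
  have h0 := hp.1
  have h1 : 0 ≤ 1 - p := sub_nonneg.2 hp.2
  have ha := Finset.card_le_card ha
  have hb := Finset.card_le_card hb
  have hc := Finset.card_le_card hc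
  have hd := Finset.card_le_card hd
  have hcard' : (E.card - a.card) + (E'.card - b.card) =
    (E.card - c.card) + (E'.card - d.card) := by omega
  calc weight ξ p q a * weight ξ' p q b
      = p ^ (a.card + b.card) * (1 - p) ^ ((E.card - a.card) + (E'.card - b.card)) *
        q ^ (numClusters ξ (a : Set L.Edge) + numClusters ξ' (b : Set L.Edge)) := by
        unfold weight; simp only [pow_add]; ring
    _ ≤ p ^ (c.card + d.card) * (1 - p) ^ ((E.card - c.card) + (E'.card - d.card)) *
        q ^ (numClusters ξ (c : Set L.Edge) + numClusters ξ' (d : Set L.Edge)) := by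
        rw [hcard, hcard']
        gcongr
    _ = _ := by unfold weight; simp only [pow_add]; ring

theorem rcProb_eq_wsum {E : Finset L.Edge} (ξ : BoundaryCondition E) (p q : ℝ)
    (A : Set L.Config) :
    rcProb ξ p q A = wsum E (weight ξ p q) A / wsum E (weight ξ p q) Set.univ := by
  rw [wsum_univ]
  rfl

theorem partition_pos (hp : p ∈ Set.Icc (0 : ℝ) 1) (hq : 1 ≤ q) {E : Finset L.Edge}
    (ξ : BoundaryCondition E) : 0 < ∑ ω ∈ E.powerset, weight ξ p q ω := by
  have hq0 : 0 < q := zero_lt_one.trans_le hq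
  -- The empty configuration has positive weight if `p < 1`, the full one if `p = 1`.
  rcases hp.2.lt_or_eq with h | h
  · refine Finset.sum_pos' (fun ω _ => weight_nonneg hp hq ξ ω) ⟨∅, by simp, ?_⟩
    have : 0 < 1 - p := sub_pos.2 h
    simp only [weight, Finset.card_empty, pow_zero, one_mul]
    positivity
  · refine Finset.sum_pos' (fun ω _ => weight_nonneg hp hq ξ ω) ⟨E, by simp, ?_⟩
    simp only [weight, h, one_pow, Nat.sub_self, pow_zero, one_mul]
    positivity

theorem wsum_univ_pos (hp : p ∈ Set.Icc (0 : ℝ) 1) (hq : 1 ≤ q) {E : Finset L.Edge}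
    (ξ : BoundaryCondition E) : 0 < wsum E (weight ξ p q) Set.univ := by
  rw [wsum_univ]
  exact partition_pos hp hq ξ

theorem openGraph_union_adj {ω ω' : L.Config} {u v : ℝ × ℝ} :
    (openGraph (ω ∪ ω')).Adj u v ↔ (openGraph ω).Adj u v ∨ (openGraph ω').Adj u v := by
  simp only [openGraph_adj, Set.mem_union, or_and_right, exists_or]

/-- Positive association. -/
theorem rcProb_mul_le (hp : p ∈ Set.Icc (0 : ℝ) 1) (hq : 1 ≤ q) (E : Finset L.Edge)
    {A B : Set L.Config} (hA : IsUpperSet A) (hB : IsUpperSet B) :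
    rcProb (wired E) p q A * rcProb (wired E) p q B ≤ rcProb (wired E) p q (A ∩ B) := by
  classical
  simp only [rcProb_eq_wsum]
  have hZ := wsum_univ_pos hp hq (wired E)
  rw [div_mul_div_comm, div_le_div_iff₀ (mul_pos hZ hZ) hZ]
  have := wsum_mul_wsum_le (U := E) (weight_nonneg hp hq (wired E)) (weight_nonneg hp hq (wired E))
    (fun a ha b hb => weight_mul_le hp hq ha hb (Finset.inter_subset_left.trans ha)
      (Finset.union_subset ha hb) (Finset.card_inter_add_card_union a b).symm ?_) hA hB
  · calc _ ≤ _ := mul_le_mul_of_nonneg_right this hZ.le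
      _ = _ := by ring
  · simp only [numClusters_wired]
    refine SimpleGraph.ncc_add_le (finite_vertices_finset E) ?_ ?_
    · intro u _ v _ h
      exact ⟨h.imp (fun h => openGraph_mono (by simp) h) id,
        h.imp (fun h => openGraph_mono (by simp) h) id⟩
    · intro u _ v _ h
      rw [Finset.coe_union, SimpleGraph.sup_adj, openGraph_union_adj] at h
      rcases h with (h | h) | h
      exacts [Or.inl (Or.inl h), Or.inr (Or.inl h), Or.inl (Or.inr h)]

/-- Free boundary conditions are dominated by wired boundary conditions. -/
theorem rcProb_free_le_wired (hp : p ∈ Set.Icc (0 : ℝ) 1) (hq : 1 ≤ q) (E : Finset L.Edge)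
    {A : Set L.Config} (hA : IsUpperSet A) :
    rcProb (free E) p q A ≤ rcProb (wired E) p q A := by
  classical
  simp only [rcProb_eq_wsum]
  rw [div_le_div_iff₀ (wsum_univ_pos hp hq _) (wsum_univ_pos hp hq _)]
  -- With the sure event as second event, the inequality becomes stochastic domination (Holley).
  have := wsum_mul_wsum_le (U := E) (weight_nonneg hp hq (free E)) (weight_nonneg hp hq (wired E))
    (fun a ha b hb => weight_mul_le hp hq ha hb (Finset.inter_subset_left.trans ha)
      (Finset.union_subset ha hb) (Finset.card_inter_add_card_union a b).symm ?_) hA isUpperSet_univ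
  · rw [Set.inter_univ] at this
    linarith
  · simp only [numClusters_wired, numClusters_free]
    refine SimpleGraph.ncc_add_le (finite_vertices_finset E) ?_ ?_
    · intro u _ v _ h
      exact ⟨openGraph_mono (by simp) h, Or.inl (openGraph_mono (by simp) h)⟩
    · intro u _ v _ h
      rw [Finset.coe_union, SimpleGraph.sup_adj, openGraph_union_adj] at h
      rcases h with (h | h) | h
      exacts [Or.inl h, Or.inr (Or.inl h), Or.inr (Or.inr h)]

theorem vertices_mono {E E' : Finset L.Edge} (h : E ⊆ E') : vertices E ⊆ vertices E' := by
  rintro v ⟨e, he, hv⟩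
  exact ⟨e, h he, hv⟩

/-- The additional vertices are isolated, so they contribute a constant that cancels when two
configurations in `E` are compared. -/
theorem numClusters_free_of_subset {E E' : Finset L.Edge} (h : E ⊆ E') {ω : L.Config} (hω : ω ⊆ E) :
    numClusters (free E') ω = numClusters (free E) ω +
      SimpleGraph.ncc (vertices E' \ vertices E) (⊥ : SimpleGraph (ℝ × ℝ)) := by
  simp only [numClusters_free]
  nth_rewrite 1 [← Set.union_sdiff_cancel (vertices_mono h)]
  rw [SimpleGraph.ncc_union (finite_vertices_finset E) ((finite_vertices_finset E').sdiff)
    Set.disjoint_sdiff_right]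
  · congr 1
    refine SimpleGraph.ncc_congr fun u hu v hv => ?_
    simp only [SimpleGraph.bot_adj, iff_false]
    exact fun h => hu.2 (openGraph_adj_vertices hω h).1
  · exact fun u hu v hv h => hv.2 (openGraph_adj_vertices hω h).2

/-- The measures with free boundary conditions increase with the domain. -/
theorem rcProb_free_mono (hp : p ∈ Set.Icc (0 : ℝ) 1) (hq : 1 ≤ q) {E E' : Finset L.Edge}
    (hE : E ⊆ E') {A : Set L.Config} (hA : IsUpperSet A) :
    rcProb (free E) p q A ≤ rcProb (free E') p q A := by
  classical
  simp only [rcProb_eq_wsum]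
  rw [div_le_div_iff₀ (wsum_univ_pos hp hq _) (wsum_univ_pos hp hq _)]
  -- The free measure on `E` is seen on `E'` by closing all edges outside `E`.
  set μ : Finset L.Edge → ℝ := fun a => if a ⊆ E then weight (free E) p q a else 0 with hμ
  have hsum : ∀ B : Set L.Config, wsum E' μ B = wsum E (weight (free E) p q) B := by
    intro B
    rw [wsum_eq_sum_ite, wsum_eq_sum_ite]
    symm
    refine Finset.sum_subset_zero_on_sdiff (Finset.powerset_mono.2 hE) ?_ ?_
    · intro a ha
      have : ¬ a ⊆ E := by simpa using (Finset.mem_sdiff.1 ha).2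
      simp [hμ, this]
    · intro a ha
      simp [hμ, Finset.mem_powerset.1 ha]
  have hμ0 : ∀ a, 0 ≤ μ a := fun a => by
    simp only [hμ]
    split_ifs
    exacts [weight_nonneg hp hq _ _, le_rfl]
  have := wsum_mul_wsum_le (U := E') hμ0 (weight_nonneg hp hq (free E')) ?_ hA isUpperSet_univ
  · rw [Set.inter_univ, hsum, hsum] at this
    linarith
  · intro a ha b hb
    by_cases haE : a ⊆ E
    · have haE' : a ∩ b ⊆ E := Finset.inter_subset_left.trans haE
      simp only [hμ, if_pos haE, if_pos haE']
      refine weight_mul_le hp hq haE hb haE' (Finset.union_subset ha hb)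
        (Finset.card_inter_add_card_union a b).symm ?_
      have h1 := numClusters_free_of_subset hE (ω := (a : Set L.Edge)) (by simpa using haE)
      have h2 := numClusters_free_of_subset hE (ω := ((a ∩ b : Finset L.Edge) : Set L.Edge))
        (by exact_mod_cast haE')
      have h3 : numClusters (free E') (a : Set L.Edge) + numClusters (free E') (b : Set L.Edge) ≤
          numClusters (free E') ((a ∩ b : Finset L.Edge) : Set L.Edge) +
          numClusters (free E') ((a ∪ b : Finset L.Edge) : Set L.Edge) := by
        simp only [numClusters_free]
        refine SimpleGraph.ncc_add_le (finite_vertices_finset E') ?_ ?_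
        · intro u _ v _ h
          exact ⟨openGraph_mono (by simp) h, openGraph_mono (by simp) h⟩
        · intro u _ v _ h
          rwa [Finset.coe_union, openGraph_union_adj] at h
      omega
    · simp only [hμ, haE, if_false, zero_mul]
      exact mul_nonneg (hμ0 _) (weight_nonneg hp hq _ _)

/-- The measures with wired boundary conditions decrease with the domain. -/
theorem rcProb_wired_anti (hp : p ∈ Set.Icc (0 : ℝ) 1) (hq : 1 ≤ q) {E E' : Finset L.Edge}
    (hE : E ⊆ E') (hne : E.Nonempty) {A : Set L.Config} (hA : IsUpperSet A)
    (hAE : DependsOnEdges A E) :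
    rcProb (wired E') p q A ≤ rcProb (wired E) p q A := by
  classical
  simp only [rcProb_eq_wsum]
  rw [div_le_div_iff₀ (wsum_univ_pos hp hq _) (wsum_univ_pos hp hq _)]
  -- Dually, the wired measure on `E` is seen on `E'` by opening all edges outside `E`.
  set ν : Finset L.Edge → ℝ := fun b => if E' \ E ⊆ b then weight (wired E) p q (b ∩ E) else 0
    with hν
  have hsum : ∀ B : Set L.Config, DependsOnEdges B E →
      wsum E' ν B = wsum E (weight (wired E) p q) B := by
    intro B hB
    rw [wsum, wsum]
    have h0 : ∑ b ∈ E'.powerset with ((b : Finset L.Edge) : Set L.Edge) ∈ B, ν b =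
        ∑ b ∈ E'.powerset with ((b : Finset L.Edge) : Set L.Edge) ∈ B ∧ E' \ E ⊆ b,
          weight (wired E) p q (b ∩ E) := by
      simp only [hν, Finset.sum_filter, ite_and]
    rw [h0]
    refine Finset.sum_nbij' (fun b => b ∩ E) (fun b => b ∪ E' \ E) ?_ ?_ ?_ ?_ ?_
    · intro b hb
      simp only [Finset.mem_filter, Finset.mem_powerset] at hb ⊢
      refine ⟨Finset.inter_subset_right, (hB _ _ fun e he => ?_).1 hb.2.1⟩
      simp [he]
    · intro b hb
      simp only [Finset.mem_filter, Finset.mem_powerset] at hb ⊢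
      refine ⟨Finset.union_subset (hb.1.trans hE) Finset.sdiff_subset,
        (hB _ _ fun e he => ?_).1 hb.2, Finset.subset_union_right⟩
      simp [he]
    · intro b hb
      simp only [Finset.mem_filter, Finset.mem_powerset] at hb
      ext e
      have h1 := @hb.1 e
      have h2 := @hb.2.2 e
      simp only [Finset.mem_union, Finset.mem_inter, Finset.mem_sdiff] at h1 h2 ⊢
      tauto
    · intro b hb
      simp only [Finset.mem_filter, Finset.mem_powerset] at hb
      ext e
      have h1 := @hb.1 e
      simp only [Finset.mem_union, Finset.mem_inter, Finset.mem_sdiff] at h1 ⊢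
      tauto
    · intro b hb
      rfl
  have hν0 : ∀ a, 0 ≤ ν a := fun a => by
    simp only [hν]
    split_ifs
    exacts [weight_nonneg hp hq _ _, le_rfl]
  have := wsum_mul_wsum_le (U := E') (weight_nonneg hp hq (wired E')) hν0 ?_ hA isUpperSet_univ
  · rw [Set.inter_univ, hsum _ hAE, hsum _ (fun _ _ _ => Iff.rfl)] at this
    linarith
  · intro a ha b hb
    by_cases hbE : E' \ E ⊆ b
    · have habE : E' \ E ⊆ a ∪ b := hbE.trans Finset.subset_union_right
      simp only [hν, if_pos hbE, if_pos habE]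
      refine weight_mul_le hp hq ha Finset.inter_subset_right (Finset.inter_subset_left.trans ha)
        Finset.inter_subset_right ?_ ?_
      · have h1 : a.card = (a ∩ E).card + (a \ E).card := (Finset.card_inter_add_card_sdiff a E).symm
        have h2 : (a ∩ b).card = (a ∩ b ∩ E).card + ((a ∩ b) \ E).card :=
          (Finset.card_inter_add_card_sdiff _ E).symm
        have h3 : (a ∩ b) \ E = a \ E := by
          ext e
          have h1 := @ha e
          have h2 := @hbE e
          simp only [Finset.mem_inter, Finset.mem_sdiff] at h1 h2 ⊢
          tauto
        have h4 := Finset.card_inter_add_card_union (a ∩ E) (b ∩ E)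
        rw [← Finset.union_inter_distrib_right, ← Finset.inter_inter_distrib_right] at h4
        rw [h3] at h2
        omega
      · simp only [numClusters_wired]
        have hV := finite_vertices_finset E'
        -- Recount the clusters of `E` on the vertices of `E'`, the exterior being wired to the
        -- boundary, so that all four cluster numbers live on one vertex set. Every edge of `E'`
        -- outside `E` then joins two wired vertices.
        have hext : ∀ x : Finset L.Edge, SimpleGraph.ncc (vertices E)
            (openGraph ((x ∩ E : Finset L.Edge) : Set L.Edge) ⊔
              SimpleGraph.completeOn (boundary E)) =
            SimpleGraph.ncc (vertices E') (openGraph ((x ∩ E : Finset L.Edge) : Set L.Edge) ⊔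
              SimpleGraph.completeOn (vertices E' \ vertices E ∪ boundary E)) := fun x =>
          SimpleGraph.ncc_sup_completeOn (finite_vertices_finset E) hV (vertices_mono hE)
            (boundary_nonempty hne) (boundary_subset E) fun u v h =>
              openGraph_adj_vertices (by simp) h
        rw [hext, hext]
        have hO : ∀ e ∈ E', e ∉ E → ∀ v ∈ (e : Sym2 (ℝ × ℝ)),
            v ∈ vertices E' \ vertices E ∪ boundary E := by
          intro e he he' v hv
          by_cases h : v ∈ vertices E
          · exact Or.inr ⟨h, e, he', hv⟩
          · exact Or.inl ⟨⟨e, he, hv⟩, h⟩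
        have hO' : ∀ v ∈ boundary E', v ∈ vertices E' \ vertices E ∪ boundary E := by
          rintro v ⟨hv, e, he, hve⟩
          by_cases h : v ∈ vertices E
          · exact Or.inr ⟨h, e, fun h' => he (hE h'), hve⟩
          · exact Or.inl ⟨hv, h⟩
        refine SimpleGraph.ncc_add_le hV ?_ ?_
        · intro u _ v _ h
          refine ⟨h.imp (fun h => openGraph_mono (by simp) h) id, ?_⟩
          rcases h with h | h
          · have hne := h.ne
            obtain ⟨e, he, hev⟩ := openGraph_adj.1 h
            have he' : e ∈ a ∧ e ∈ b := by simpa using he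
            by_cases h' : e ∈ E
            · exact Or.inl (openGraph_adj.2 ⟨e, by simp [he', h'], hev⟩)
            · exact Or.inr ⟨hne, hO e (ha he'.1) h' u (by simp [hev]),
                hO e (ha he'.1) h' v (by simp [hev])⟩
          · exact Or.inr ⟨h.1, hO' u h.2.1, hO' v h.2.2⟩
        · intro u _ v _ h
          rw [SimpleGraph.sup_adj, Finset.union_inter_distrib_right, Finset.coe_union,
            openGraph_union_adj] at h
          rcases h with (h | h) | h
          exacts [Or.inl (Or.inl (openGraph_mono (by simp) h)), Or.inr (Or.inl h),
            Or.inr (Or.inr h)]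
    · simp only [hν, hbE, if_false, mul_zero]
      exact mul_nonneg (weight_nonneg hp hq _ _) (hν0 _)

end weights

end PlanarLattice

/-! ### Exploration of the boundary cluster and the domain Markov property. -/

namespace PlanarLattice

variable {L : PlanarLattice} {p q : ℝ}

/-- The vertices connected to the boundary of `E`. -/
def boundaryCluster (E : Finset L.Edge) (ω : L.Config) : Set (ℝ × ℝ) :=
  {v | ∃ b ∈ boundary E, (openGraph ω).Reachable b v}

theorem boundary_subset_boundaryCluster (E : Finset L.Edge) (ω : L.Config) :
    boundary E ⊆ boundaryCluster E ω := fun b hb => ⟨b, hb, SimpleGraph.Reachable.refl _⟩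

open scoped Classical in
/-- The edges of `E` without endpoints in the cluster of the boundary. -/
noncomputable def innerEdges (E : Finset L.Edge) (ω : L.Config) : Finset L.Edge :=
  E.filter fun e => ∀ v ∈ (e : Sym2 (ℝ × ℝ)), v ∉ boundaryCluster E ω

theorem mem_innerEdges {E : Finset L.Edge} {ω : L.Config} {e : L.Edge} :
    e ∈ innerEdges E ω ↔ e ∈ E ∧ ∀ v ∈ (e : Sym2 (ℝ × ℝ)), v ∉ boundaryCluster E ω := by
  simp [innerEdges]

theorem innerEdges_subset (E : Finset L.Edge) (ω : L.Config) : innerEdges E ω ⊆ E :=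
  fun _ h => (mem_innerEdges.1 h).1

theorem mem_boundaryCluster_of_edge {E : Finset L.Edge} {ω : L.Config} {e : L.Edge} (he : e ∈ ω)
    {u v : ℝ × ℝ} (hu : u ∈ (e : Sym2 (ℝ × ℝ))) (hv : v ∈ (e : Sym2 (ℝ × ℝ)))
    (h : u ∈ boundaryCluster E ω) : v ∈ boundaryCluster E ω := by
  obtain ⟨b, hb, hbu⟩ := h
  refine ⟨b, hb, hbu.trans ?_⟩
  by_cases huv : u = v
  · rw [huv]
  · exact (openGraph_adj.2 ⟨e, he, (Sym2.mem_and_mem_iff huv).1 ⟨hu, hv⟩⟩).reachable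

/-- A walk started on the boundary only uses open edges touching the cluster, so only these have to
remain open. -/
theorem boundaryCluster_subset_of_sdiff {E : Finset L.Edge} {ω ω' : L.Config}
    (h : ∀ e ∈ ω, (∃ v ∈ (e : Sym2 (ℝ × ℝ)), v ∈ boundaryCluster E ω) → e ∈ ω') :
    boundaryCluster E ω ⊆ boundaryCluster E ω' := by
  rintro v ⟨b, hb, ⟨w⟩⟩
  suffices ∀ u v (w : (openGraph ω).Walk u v), u ∈ boundaryCluster E ω →
      u ∈ boundaryCluster E ω' → v ∈ boundaryCluster E ω' from
    this b v w (boundary_subset_boundaryCluster _ _ hb) (boundary_subset_boundaryCluster _ _ hb)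
  intro u v w
  induction w with
  | nil => exact fun _ h => h
  | @cons a b c hab _ ih =>
    intro ha ha'
    obtain ⟨e, he, hev⟩ := openGraph_adj.1 hab
    have hmem : a ∈ (e : Sym2 (ℝ × ℝ)) := by simp [hev]
    have hmem' : b ∈ (e : Sym2 (ℝ × ℝ)) := by simp [hev]
    exact ih (mem_boundaryCluster_of_edge he hmem hmem' ha)
      (mem_boundaryCluster_of_edge (h e he ⟨a, hmem, ha⟩) hmem hmem' ha')

/-- Changing the configuration in the inner edges does not change the cluster of the boundary. -/
theorem boundaryCluster_eq {E : Finset L.Edge} {ω ω' : L.Config}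
    (h : ∀ e ∉ innerEdges E ω, e ∈ ω' ↔ e ∈ ω) :
    boundaryCluster E ω' = boundaryCluster E ω := by
  apply le_antisymm
  · rintro v ⟨b, hb, ⟨w⟩⟩
    suffices ∀ u v (w : (openGraph ω').Walk u v), u ∈ boundaryCluster E ω →
        v ∈ boundaryCluster E ω from this b v w (boundary_subset_boundaryCluster _ _ hb)
    intro u v w
    induction w with
    | nil => exact fun h => h
    | @cons a b c hab _ ih =>
      intro ha
      obtain ⟨e, he, hev⟩ := openGraph_adj.1 hab
      have hmem : a ∈ (e : Sym2 (ℝ × ℝ)) := by simp [hev]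
      have hmem' : b ∈ (e : Sym2 (ℝ × ℝ)) := by simp [hev]
      have : e ∉ innerEdges E ω := fun h => (mem_innerEdges.1 h).2 a hmem ha
      exact ih (mem_boundaryCluster_of_edge ((h e this).1 he) hmem hmem' ha)
  · refine boundaryCluster_subset_of_sdiff fun e he hev => ?_
    obtain ⟨v, hv, hv'⟩ := hev
    exact (h e fun h' => (mem_innerEdges.1 h').2 v hv hv').2 he

/-- The unexplored region is determined by the states outside it. Hence, given this region and the
outside configuration, the states inside are unconstrained. -/
theorem innerEdges_eq {E : Finset L.Edge} {ω ω' : L.Config}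
    (h : ∀ e ∉ innerEdges E ω, e ∈ ω' ↔ e ∈ ω) : innerEdges E ω' = innerEdges E ω := by
  rw [innerEdges, innerEdges, boundaryCluster_eq h]

open SimpleGraph in
/-- Inside the inner edges, the number of clusters is counted with free boundary conditions. -/
theorem numClusters_wired_union {E : Finset L.Edge} {ω : L.Config} (hω : ω ⊆ E)
    {a : L.Config} (ha : a ⊆ innerEdges E ω) :
    numClusters (wired E) (ω \ innerEdges E ω ∪ a) =
      numClusters (free (innerEdges E ω)) a +
        ncc (vertices E \ vertices (innerEdges E ω))
          (openGraph (ω \ innerEdges E ω) ⊔ completeOn (boundary E)) := by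
  set D := innerEdges E ω with hD
  have hDC : ∀ v ∈ vertices D, v ∉ boundaryCluster E ω := by
    rintro v ⟨e, he, hv⟩
    exact (mem_innerEdges.1 he).2 v hv
  -- An open edge at a vertex of `D` has no endpoint in the boundary cluster, which would otherwise
  -- contain that vertex; so the edge belongs to `D`.
  have hη : ∀ u v, (openGraph (ω \ D)).Adj u v → u ∉ vertices D := by
    intro u v huv hu
    obtain ⟨e, he, hev⟩ := openGraph_adj.1 huv
    have hmem : u ∈ (e : Sym2 (ℝ × ℝ)) := by simp [hev]
    refine he.2 (mem_innerEdges.2 ⟨hω he.1, fun v hv hvC => ?_⟩)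
    exact hDC u hu (mem_boundaryCluster_of_edge he.1 hv hmem hvC)
  have hB : ∀ u ∈ boundary E, u ∉ vertices D := fun u hu hu' =>
    hDC u hu' (boundary_subset_boundaryCluster _ _ hu)
  rw [numClusters_wired, numClusters_free]
  nth_rewrite 1 [← Set.union_sdiff_cancel (vertices_mono (innerEdges_subset E ω))]
  rw [ncc_union (finite_vertices_finset _) ((finite_vertices_finset E).sdiff)
    Set.disjoint_sdiff_right]
  · congr 1
    · refine ncc_congr fun u hu v hv => ?_
      rw [sup_adj, openGraph_union_adj]
      exact ⟨fun h => h.elim (fun h => h.elim (fun h => (hη u v h hu).elim) id)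
        (fun h => (hB u h.2.1 hu).elim), fun h => Or.inl (Or.inr h)⟩
    · refine ncc_congr fun u hu v hv => ?_
      rw [sup_adj, sup_adj, openGraph_union_adj]
      exact ⟨fun h => h.imp (fun h => h.elim id
        (fun h => (hu.2 (openGraph_adj_vertices ha h).1).elim)) id,
        fun h => h.imp Or.inl id⟩
  · intro u hu v hv h
    rw [sup_adj, openGraph_union_adj] at h
    rcases h with (h | h) | h
    · exact hη u v h hu
    · exact hv.2 (openGraph_adj_vertices ha h).2
    · exact hB u h.2.1 hu

/-- The event that no edge of `F` has an endpoint connected to the boundary of `E`. -/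
def notToBoundary (E F : Finset L.Edge) : Set L.Config :=
  {ω | ∀ e ∈ F, ∀ v ∈ (e : Sym2 (ℝ × ℝ)), v ∉ boundaryCluster E ω}

/-- Exploration of the cluster of the boundary: if it does not touch `F`, then an increasing event
depending on `F` is dominated by the free boundary conditions. -/
theorem rcProb_wired_inter_notToBoundary_le (hp : p ∈ Set.Icc (0 : ℝ) 1) (hq : 1 ≤ q)
    {E F : Finset L.Edge} (hFE : F ⊆ E) {A : Set L.Config} (hA : IsUpperSet A)
    (hAF : DependsOnEdges A F) :
    rcProb (wired E) p q (A ∩ notToBoundary E F) ≤ rcProb (free E) p q A := by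
  classical
  have hp0 := hp.1
  have hp1 : 0 ≤ 1 - p := sub_nonneg.2 hp.2
  set Φ : Finset (Finset L.Edge) := E.powerset.filter fun ω => (ω : Set L.Edge) ∈ notToBoundary E F
    with hΦ
  -- The sum is split according to the unexplored region and the configuration outside it. On each
  -- fibre the measure is, up to a factor, the free one on that region.
  set π : Finset L.Edge → Finset L.Edge × Finset L.Edge :=
    fun ω => (innerEdges E ω, ω \ innerEdges E ω) with hπ
  have h1 : wsum E (weight (wired E) p q) (A ∩ notToBoundary E F) =
      ∑ ω ∈ Φ, if (ω : Set L.Edge) ∈ A then weight (wired E) p q ω else 0 := by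
    rw [wsum_eq_sum_ite, hΦ, Finset.sum_filter]
    refine Finset.sum_congr rfl fun ω _ => ?_
    by_cases h : (ω : Set L.Edge) ∈ A <;> simp [h]
  have h2 : ∑ ω ∈ Φ, weight (wired E) p q ω ≤ wsum E (weight (wired E) p q) Set.univ := by
    rw [wsum_univ]
    exact Finset.sum_le_sum_of_subset_of_nonneg (Finset.filter_subset _ _)
      fun ω _ _ => weight_nonneg hp hq _ _
  have hfib : ∀ y ∈ Φ.image π,
      (∑ ω ∈ Φ with π ω = y, if (ω : Set L.Edge) ∈ A then weight (wired E) p q ω else 0) ≤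
        rcProb (free E) p q A * ∑ ω ∈ Φ with π ω = y, weight (wired E) p q ω := by
    intro y hy
    obtain ⟨ω₀, hω₀, rfl⟩ := Finset.mem_image.1 hy
    obtain ⟨hω₀E, hω₀N⟩ := Finset.mem_filter.1 hω₀
    rw [Finset.mem_powerset] at hω₀E
    set D := innerEdges E (ω₀ : Set L.Edge) with hD
    have hDE : D ⊆ E := innerEdges_subset _ _
    have hFD : F ⊆ D := fun e he => mem_innerEdges.2 ⟨hFE he, hω₀N e he⟩
    set η := ω₀ \ D with hη
    -- The weight of everything outside `D`; it is the same for all configurations in the fibre and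
    -- may vanish.
    set κ : ℝ := p ^ η.card * (1 - p) ^ ((E.card - D.card) - η.card) *
      q ^ SimpleGraph.ncc (vertices E \ vertices D)
          (openGraph ((ω₀ : Set L.Edge) \ D) ⊔ SimpleGraph.completeOn (boundary E)) with hκ
    have hκ0 : 0 ≤ κ := by positivity
    have hηD : Disjoint η D := Finset.sdiff_disjoint
    have hcoe : ∀ a : Finset L.Edge, ((η ∪ a : Finset L.Edge) : Set L.Edge) =
        (ω₀ : Set L.Edge) \ D ∪ a := fun a => by rw [hη]; push_cast; rfl
    have hE : ∀ a ⊆ D, η ∪ a ⊆ E := fun a ha =>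
      Finset.union_subset (Finset.sdiff_subset.trans hω₀E) (ha.trans hDE)
    have hchange : ∀ a ⊆ D, ∀ e ∉ D, e ∈ ((η ∪ a : Finset L.Edge) : Set L.Edge) ↔
        e ∈ (ω₀ : Set L.Edge) := by
      intro a ha e he
      have := @ha e
      simp only [hη, Finset.mem_coe, Finset.mem_union, Finset.mem_sdiff]
      tauto
    have hbij : ∀ f : Finset L.Edge → ℝ, ∑ ω ∈ Φ with π ω = π ω₀, f ω =
        ∑ a ∈ D.powerset, f (η ∪ a) := by
      intro f
      symm
      refine Finset.sum_nbij' (fun a => η ∪ a) (fun ω => ω ∩ D) ?_ ?_ ?_ ?_ fun _ _ => rfl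
      · intro a ha
        rw [Finset.mem_powerset] at ha
        have h3 := innerEdges_eq (hchange a ha)
        have h4 := boundaryCluster_eq (hchange a ha)
        refine Finset.mem_filter.2 ⟨Finset.mem_filter.2 ⟨Finset.mem_powerset.2 (hE a ha), ?_⟩, ?_⟩
        · simp only [notToBoundary, Set.mem_ofPred_eq, h4]
          exact hω₀N
        · simp only [hπ, h3]
          refine Prod.ext rfl ?_
          ext e
          have := @ha e
          simp only [hη, Finset.mem_union, Finset.mem_sdiff]
          tauto
      · intro ω _
        exact Finset.mem_powerset.2 Finset.inter_subset_right
      · intro a ha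
        rw [Finset.mem_powerset] at ha
        ext e
        have := @ha e
        simp only [hη, Finset.mem_union, Finset.mem_sdiff, Finset.mem_inter]
        tauto
      · intro ω hω
        have h5 := (Finset.mem_filter.1 hω).2
        simp only [hπ, Prod.mk.injEq] at h5
        have h6 : η = ω \ D := by rw [hη, hD, ← h5.2, h5.1]
        rw [h6]
        exact Finset.sdiff_union_inter ω D
    have hweight : ∀ a ∈ D.powerset,
        weight (wired E) p q (η ∪ a) = κ * weight (free D) p q a := by
      intro a ha
      rw [Finset.mem_powerset] at ha
      have hcard : (η ∪ a).card = η.card + a.card :=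
        Finset.card_union_of_disjoint (hηD.mono_right ha)
      have hk := numClusters_wired_union (E := E) (ω := (ω₀ : Set L.Edge))
        (by exact_mod_cast hω₀E) (a := (a : Set L.Edge)) (by exact_mod_cast ha)
      have h7 := Finset.card_le_card (Finset.union_subset (Finset.sdiff_subset.trans hω₀E) hDE :
        η ∪ D ⊆ E)
      rw [Finset.card_union_of_disjoint hηD] at h7
      have h8 := Finset.card_le_card ha
      have h9 : E.card - (η.card + a.card) =
        ((E.card - D.card) - η.card) + (D.card - a.card) := by omega
      rw [weight, weight, hcard, hcoe, hk, h9, hκ]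
      simp only [pow_add]
      ring
    have hevent : ∀ a ∈ D.powerset, ((η ∪ a : Finset L.Edge) : Set L.Edge) ∈ A ↔
        (a : Set L.Edge) ∈ A := by
      intro a _
      refine hAF _ _ fun e he => ?_
      have := hFD he
      simp only [hη, Finset.mem_coe, Finset.mem_union, Finset.mem_sdiff]
      tauto
    rw [hbij, hbij]
    have h10 : (∑ a ∈ D.powerset, if ((η ∪ a : Finset L.Edge) : Set L.Edge) ∈ A then
        weight (wired E) p q (η ∪ a) else 0) = κ * wsum D (weight (free D) p q) A := by
      rw [wsum_eq_sum_ite, Finset.mul_sum]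
      refine Finset.sum_congr rfl fun a ha => ?_
      rw [if_congr (hevent a ha) rfl rfl, hweight a ha, mul_ite, mul_zero]
    have h11 : ∑ a ∈ D.powerset, weight (wired E) p q (η ∪ a) =
        κ * wsum D (weight (free D) p q) Set.univ := by
      rw [wsum_univ, Finset.mul_sum]
      exact Finset.sum_congr rfl hweight
    have hZ := wsum_univ_pos hp hq (free D)
    have h12 : wsum D (weight (free D) p q) A =
        rcProb (free D) p q A * wsum D (weight (free D) p q) Set.univ := by
      rw [rcProb_eq_wsum, div_mul_cancel₀ _ hZ.ne']
    rw [h10, h11, h12]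
    have h13 := rcProb_free_mono hp hq hDE hA
    calc _ = rcProb (free D) p q A * (κ * wsum D (weight (free D) p q) Set.univ) := by ring
      _ ≤ _ := by gcongr
  rw [rcProb_eq_wsum, div_le_iff₀ (wsum_univ_pos hp hq _), h1]
  have hA0 : 0 ≤ rcProb (free E) p q A :=
    div_nonneg (Finset.sum_nonneg fun _ _ => weight_nonneg hp hq _ _)
      (partition_pos hp hq _).le
  calc _ = ∑ y ∈ Φ.image π, ∑ ω ∈ Φ with π ω = y,
        (if (ω : Set L.Edge) ∈ A then weight (wired E) p q ω else 0) :=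
        (Finset.sum_fiberwise_of_maps_to (fun ω hω => Finset.mem_image_of_mem π hω) _).symm
    _ ≤ ∑ y ∈ Φ.image π, rcProb (free E) p q A * ∑ ω ∈ Φ with π ω = y, weight (wired E) p q ω :=
        Finset.sum_le_sum hfib
    _ = rcProb (free E) p q A * ∑ ω ∈ Φ, weight (wired E) p q ω := by
        rw [← Finset.mul_sum,
          Finset.sum_fiberwise_of_maps_to (fun ω hω => Finset.mem_image_of_mem π hω)]
    _ ≤ _ := by gcongr

end PlanarLattice

/-! ### Boxes and existence of the infinite-volume measures. -/

namespace PlanarLattice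

variable {L : PlanarLattice} {p q : ℝ}

theorem mem_box {n : ℕ} {e : L.Edge} :
    e ∈ L.box n ↔ ∃ v ∈ (e : Sym2 (ℝ × ℝ)), v ∈ Set.Icc (-n : ℝ) n ×ˢ Set.Icc (-n : ℝ) n := by
  rw [box, Set.Finite.mem_toFinset]
  rfl

theorem box_mono {m n : ℕ} (h : m ≤ n) : L.box m ⊆ L.box n := by
  intro e he
  rw [mem_box] at he ⊢
  obtain ⟨v, hv, hv'⟩ := he
  have h' : (m : ℝ) ≤ n := by exact_mod_cast h
  exact ⟨v, hv, Set.prod_mono (Set.Icc_subset_Icc (neg_le_neg h') h')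
    (Set.Icc_subset_Icc (neg_le_neg h') h') hv'⟩

theorem exists_mem_box (e : L.Edge) : ∃ n, e ∈ L.box n := by
  obtain ⟨v, hv⟩ : ∃ v, v ∈ (e : Sym2 (ℝ × ℝ)) := ⟨_, Sym2.out_fst_mem _⟩
  obtain ⟨n, hn⟩ := exists_nat_ge (max |v.1| |v.2|)
  refine ⟨n, mem_box.2 ⟨v, hv, ?_⟩⟩
  exact ⟨abs_le.1 ((le_max_left _ _).trans hn), abs_le.1 ((le_max_right _ _).trans hn)⟩

/-- Countability makes the open sets of `L.Edge → Bool` measurable for the product σ-algebra, as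
weak convergence requires. -/
instance : Countable L.Edge := by
  rw [← Set.countable_univ_iff]
  refine (Set.countable_iUnion fun n => (L.box n).countable_toSet).mono fun e _ => ?_
  exact Set.mem_iUnion.2 (exists_mem_box e)

theorem tendsto_box : Tendsto L.box atTop atTop :=
  tendsto_atTop_finset_of_monotone (fun _ _ h => box_mono h) exists_mem_box

theorem zero_mem_vertices_box (n : ℕ) : (0 : ℝ × ℝ) ∈ vertices (L.box n) := by
  obtain ⟨w, hw⟩ := L.zero_mem
  exact ⟨⟨s(0, w), hw⟩, mem_box.2 ⟨0, by simp, by simp [Prod.le_def]⟩, by simp⟩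

theorem box_nonempty (n : ℕ) : (L.box n).Nonempty := by
  obtain ⟨e, he, -⟩ := zero_mem_vertices_box (L := L) n
  exact ⟨e, he⟩

/-- The random-cluster measure as a measure. -/
noncomputable def rcMeasure {E : Finset L.Edge} (ξ : BoundaryCondition E) (p q : ℝ) :
    Measure L.Config :=
  ∑ ω ∈ E.powerset, ENNReal.ofReal (weight ξ p q ω / ∑ ω ∈ E.powerset, weight ξ p q ω) •
    Measure.dirac (ω : Set L.Edge)

theorem rcMeasure_real (hp : p ∈ Set.Icc (0 : ℝ) 1) (hq : 1 ≤ q) {E : Finset L.Edge}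
    (ξ : BoundaryCondition E) (A : Set L.Config) :
    (rcMeasure ξ p q).real A = rcProb ξ p q A := by
  classical
  have hZ := partition_pos hp hq ξ
  rw [rcProb_eq_wsum, wsum_eq_sum_ite, wsum_univ, Finset.sum_div, Measure.real, rcMeasure,
    Measure.finsetSum_apply, ENNReal.toReal_sum]
  · refine Finset.sum_congr rfl fun ω _ => ?_
    rw [Measure.smul_apply, Measure.dirac_apply, smul_eq_mul, ENNReal.toReal_mul,
      ENNReal.toReal_ofReal (div_nonneg (weight_nonneg hp hq ξ ω) hZ.le)]
    by_cases h : (ω : Set L.Edge) ∈ A <;> simp [h]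
  · intro ω _
    rw [Measure.smul_apply, Measure.dirac_apply, smul_eq_mul]
    refine ENNReal.mul_ne_top ENNReal.ofReal_ne_top ?_
    by_cases h : (ω : Set L.Edge) ∈ A <;> simp [h]

theorem isProbabilityMeasure_rcMeasure (hp : p ∈ Set.Icc (0 : ℝ) 1) (hq : 1 ≤ q)
    {E : Finset L.Edge} (ξ : BoundaryCondition E) : IsProbabilityMeasure (rcMeasure ξ p q) := by
  have h := rcMeasure_real hp hq ξ Set.univ
  rw [rcProb_eq_wsum, div_self (wsum_univ_pos hp hq ξ).ne', Measure.real,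
    ENNReal.toReal_eq_one_iff] at h
  exact ⟨h⟩

section basic

variable (hp : p ∈ Set.Icc (0 : ℝ) 1) (hq : 1 ≤ q) {E : Finset L.Edge} (ξ : BoundaryCondition E)

include hp hq

theorem rcProb_mono {A B : Set L.Config} (h : ∀ ω : Finset L.Edge, ω ⊆ E →
    (ω : Set L.Edge) ∈ A → (ω : Set L.Edge) ∈ B) : rcProb ξ p q A ≤ rcProb ξ p q B := by
  classical
  rw [rcProb_eq_wsum, rcProb_eq_wsum]
  refine div_le_div_of_nonneg_right ?_ (wsum_univ_pos hp hq ξ).le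
  rw [wsum_eq_sum_ite, wsum_eq_sum_ite]
  refine Finset.sum_le_sum fun ω hω => ?_
  have := h ω (Finset.mem_powerset.1 hω)
  have h0 := weight_nonneg hp hq ξ ω
  split_ifs with h1 h2 <;> first | exact le_rfl | exact h0 | exact (h2 (this h1)).elim

theorem rcProb_nonneg (A : Set L.Config) : 0 ≤ rcProb ξ p q A := by
  rw [← rcMeasure_real hp hq]
  exact measureReal_nonneg

theorem rcProb_le_one (A : Set L.Config) : rcProb ξ p q A ≤ 1 := by
  have := isProbabilityMeasure_rcMeasure hp hq ξ
  rw [← rcMeasure_real hp hq]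
  exact measureReal_le_one

theorem rcProb_union_le (A B : Set L.Config) :
    rcProb ξ p q (A ∪ B) ≤ rcProb ξ p q A + rcProb ξ p q B := by
  simp only [← rcMeasure_real hp hq]
  exact measureReal_union_le A B

theorem rcProb_biUnion_le {ι : Type*} (s : Finset ι) (A : ι → Set L.Config) :
    rcProb ξ p q (⋃ i ∈ s, A i) ≤ ∑ i ∈ s, rcProb ξ p q (A i) := by
  have := isProbabilityMeasure_rcMeasure hp hq ξ
  simp only [← rcMeasure_real hp hq]
  exact measureReal_biUnion_finset_le s A

theorem rcProb_inter_add_inter_notMem (e : L.Edge) (A : Set L.Config) :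
    rcProb ξ p q A = rcProb ξ p q (A ∩ {ω | e ∈ ω}) + rcProb ξ p q (A ∩ {ω | e ∉ ω}) := by
  have := isProbabilityMeasure_rcMeasure hp hq ξ
  simp only [← rcMeasure_real hp hq]
  exact (measureReal_inter_add_sdiff (s := A) (measurableSet_mem e)).symm

end basic

/-- If the probabilities that given edges are open converge, then so do the probabilities of all
events depending on finitely many edges. -/
theorem exists_tendsto_rcProb (hp : p ∈ Set.Icc (0 : ℝ) 1) (hq : 1 ≤ q)
    {bc : ∀ E : Finset L.Edge, BoundaryCondition E}
    (h : ∀ S : Finset L.Edge, ∃ x, Tendsto (fun E => rcProb (bc E) p q {ω | (S : Set L.Edge) ⊆ ω})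
      atTop (𝓝 x)) (F : Finset L.Edge) (A : Set L.Config) (hA : DependsOnEdges A F) :
    ∃ x, Tendsto (fun E => rcProb (bc E) p q A) atTop (𝓝 x) := by
  classical
  -- Inclusion-exclusion, one closed edge at a time: "`e` closed" is the difference of "no condition
  -- on `e`" and "`e` open".
  have h1 : ∀ T S : Finset L.Edge, ∃ x, Tendsto (fun E => rcProb (bc E) p q
      {ω | (S : Set L.Edge) ⊆ ω ∧ ∀ e ∈ T, e ∉ ω}) atTop (𝓝 x) := by
    intro T
    induction T using Finset.induction_on with
    | empty => simpa using h
    | insert e T _ ih =>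
      intro S
      obtain ⟨x, hx⟩ := ih S
      obtain ⟨y, hy⟩ := ih (insert e S)
      refine ⟨x - y, (hx.sub hy).congr fun E => ?_⟩
      rw [rcProb_inter_add_inter_notMem hp hq (bc E) e, sub_eq_iff_eq_add, add_comm]
      congr 2 <;> ext ω <;>
        simp only [Set.mem_inter_iff, Set.mem_ofPred_eq, Finset.coe_insert, Set.insert_subset_iff,
          Finset.forall_mem_insert] <;> tauto
  -- The event is split by the state of one edge of `F` after another; `S` and `T` record the edges
  -- already found open and closed.
  suffices h2 : ∀ (F : Finset L.Edge) (A : Set L.Config), DependsOnEdges A F →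
      ∀ T S : Finset L.Edge, ∃ x, Tendsto (fun E => rcProb (bc E) p q
      (A ∩ {ω | (S : Set L.Edge) ⊆ ω ∧ ∀ e ∈ T, e ∉ ω})) atTop (𝓝 x) by
    simpa using h2 F A hA ∅ ∅
  intro F
  induction F using Finset.induction_on with
  | empty =>
    intro A hA T S
    by_cases hne : A.Nonempty
    · obtain ⟨ω, hω⟩ := hne
      have : A = Set.univ := Set.eq_univ_of_forall fun ω' => (hA ω ω' (by simp)).1 hω
      simpa [this] using h1 T S
    · rw [Set.not_nonempty_iff_eq_empty] at hne
      subst hne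
      refine ⟨0, tendsto_const_nhds.congr fun E => ?_⟩
      simp [rcProb]
  | insert e F _ ih =>
    intro A hA T S
    obtain ⟨x, hx⟩ := ih {ω | insert e ω ∈ A} (fun ω ω' hω => hA _ _ fun f hf => by
      rcases Finset.mem_insert.1 hf with rfl | hf
      · simp
      · simp [hω f hf]) T (insert e S)
    obtain ⟨y, hy⟩ := ih {ω | ω \ {e} ∈ A} (fun ω ω' hω => hA _ _ fun f hf => by
      rcases Finset.mem_insert.1 hf with rfl | hf
      · simp
      · simp [hω f hf]) (insert e T) S
    refine ⟨x + y, (hx.add hy).congr fun E => ?_⟩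
    rw [rcProb_inter_add_inter_notMem hp hq (bc E) e (A ∩ _)]
    congr 2 <;> ext ω <;>
      simp only [Set.mem_inter_iff, Set.mem_ofPred_eq, Finset.coe_insert, Set.insert_subset_iff,
        Finset.forall_mem_insert]
    · constructor
      · rintro ⟨h1, ⟨h2, h3⟩, h4⟩
        rw [Set.insert_eq_of_mem h2] at h1
        exact ⟨⟨h1, h3, h4⟩, h2⟩
      · rintro ⟨⟨h1, h3, h4⟩, h2⟩
        exact ⟨by rwa [Set.insert_eq_of_mem h2], ⟨h2, h3⟩, h4⟩
    · constructor
      · rintro ⟨h1, h2, h3, h4⟩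
        rw [Set.sdiff_singleton_eq_self h3] at h1
        exact ⟨⟨h1, h2, h4⟩, h3⟩
      · rintro ⟨⟨h1, h2, h4⟩, h3⟩
        exact ⟨by rwa [Set.sdiff_singleton_eq_self h3], h2, h3, h4⟩

/-- Existence of the infinite-volume measure, by compactness. -/
theorem exists_isInfiniteVolumeMeasure (hp : p ∈ Set.Icc (0 : ℝ) 1) (hq : 1 ≤ q)
    {bc : ∀ E : Finset L.Edge, BoundaryCondition E}
    (h : ∀ S : Finset L.Edge, ∃ x, Tendsto (fun E => rcProb (bc E) p q {ω | (S : Set L.Edge) ⊆ ω})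
      atTop (𝓝 x)) : ∃ φ, IsInfiniteVolumeMeasure bc p q φ := by
  classical
  let f : L.Config → (L.Edge → Bool) := fun ω e => decide (e ∈ ω)
  let g : (L.Edge → Bool) → L.Config := fun x => {e | x e = true}
  have hgf : ∀ ω, g (f ω) = ω := fun ω => by ext e; simp [f, g]
  have hf : Measurable f := by
    refine measurable_pi_iff.2 fun e => measurable_to_bool ?_
    convert measurableSet_mem e using 1
    ext ω
    simp [f]
  have hg : Measurable g := by
    refine measurable_set_iff.2 fun e => ?_
    have : Measurable fun x : L.Edge → Bool => x e := measurable_pi_apply e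
    exact (Measurable.of_discrete (f := fun b : Bool => b = true)).comp this
  have hP : ∀ E, IsProbabilityMeasure (rcMeasure (bc E) p q) := fun E =>
    isProbabilityMeasure_rcMeasure hp hq (bc E)
  let μ : Finset L.Edge → ProbabilityMeasure (L.Edge → Bool) := fun E =>
    ⟨(rcMeasure (bc E) p q).map f, Measure.isProbabilityMeasure_map hf.aemeasurable⟩
  -- The space of probability measures on `L.Edge → Bool` is compact, so there is a limit along an
  -- ultrafilter finer than `atTop`. It agrees with the limit along `atTop`, already known to exist
  -- for each local event.
  let U : Ultrafilter (Finset L.Edge) := Ultrafilter.of atTop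
  let ν : ProbabilityMeasure (L.Edge → Bool) := (U.map μ).lim
  have hν : Tendsto μ U (𝓝 ν) := (U.map μ).le_nhds_lim
  refine ⟨(ν : Measure (L.Edge → Bool)).map g,
    Measure.isProbabilityMeasure_map hg.aemeasurable, fun F A hA => ?_⟩
  -- Local events are clopen, so weak convergence applies to their probabilities.
  have hclopen : IsClopen (g ⁻¹' A) := by
    have : g ⁻¹' A = (fun x : L.Edge → Bool => fun e : F => x e) ⁻¹'
        ((fun x : L.Edge → Bool => fun e : F => x e) '' (g ⁻¹' A)) := by
      refine (Set.subset_preimage_image _ _).antisymm ?_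
      rintro x ⟨y, hy, hxy⟩
      refine (hA _ _ fun e he => ?_).1 hy
      have := congrFun hxy ⟨e, he⟩
      simp only at this
      simp [g, this]
    rw [this]
    exact (isClopen_discrete _).preimage (by fun_prop)
  have hAm : MeasurableSet A := by
    have : f ⁻¹' (g ⁻¹' A) = A := by ext ω; simp [hgf]
    rw [← this]
    exact hf hclopen.1.measurableSet
  obtain ⟨x, hx⟩ := exists_tendsto_rcProb hp hq h F A hA
  have h1 := ProbabilityMeasure.tendsto_measure_of_isClopen_of_tendsto hν hclopen
  have h2 : ∀ E, ((μ E : Measure (L.Edge → Bool)).real (g ⁻¹' A)) = rcProb (bc E) p q A := by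
    intro E
    rw [← rcMeasure_real hp hq]
    change ((rcMeasure (bc E) p q).map f).real _ = _
    rw [map_measureReal_apply hf hclopen.1.measurableSet]
    congr 1
    ext ω
    simp [hgf]
  have h3 : Tendsto (fun E => rcProb (bc E) p q A) U
      (𝓝 ((ν : Measure (L.Edge → Bool)).real (g ⁻¹' A))) := by
    simp only [← h2]
    exact (NNReal.continuous_coe.tendsto _).comp h1
  rw [map_measureReal_apply hg hAm, tendsto_nhds_unique h3 (hx.mono_left (Ultrafilter.of_le atTop))]
  exact hx

theorem isUpperSet_superset (S : Finset L.Edge) : IsUpperSet {ω : L.Config | (S : Set L.Edge) ⊆ ω} :=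
  fun _ _ h h' => h'.trans h

theorem dependsOnEdges_superset {S F : Finset L.Edge} (h : S ⊆ F) :
    DependsOnEdges {ω : L.Config | (S : Set L.Edge) ⊆ ω} F :=
  fun _ _ hω => forall₂_congr fun e he => hω e (h he)

theorem exists_free_measure (hp : p ∈ Set.Icc (0 : ℝ) 1) (hq : 1 ≤ q) :
    ∃ φ : Measure L.Config, IsInfiniteVolumeMeasure free p q φ := by
  refine exists_isInfiniteVolumeMeasure hp hq fun S => ⟨_, tendsto_atTop_ciSup ?_ ?_⟩
  · exact fun E E' h => rcProb_free_mono hp hq h (isUpperSet_superset S)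
  · refine ⟨1, ?_⟩
    rintro _ ⟨E, rfl⟩
    exact rcProb_le_one hp hq _ _

theorem exists_wired_measure (hp : p ∈ Set.Icc (0 : ℝ) 1) (hq : 1 ≤ q) :
    ∃ φ : Measure L.Config, IsInfiniteVolumeMeasure wired p q φ := by
  classical
  refine exists_isInfiniteVolumeMeasure hp hq fun S => ?_
  -- Monotonicity needs a nonempty domain containing `S`; adding `E₀` to every domain makes the net
  -- decreasing throughout and changes nothing eventually.
  let E₀ := L.box 0 ∪ S
  have hE₀ : E₀.Nonempty := (box_nonempty 0).mono Finset.subset_union_left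
  refine ⟨_, (tendsto_atTop_ciInf (f := fun E => rcProb (wired (E ∪ E₀)) p q
    {ω | (S : Set L.Edge) ⊆ ω}) ?_ ?_).congr' ?_⟩
  · exact fun E E' h => rcProb_wired_anti hp hq (Finset.union_subset_union_left h)
      (hE₀.mono Finset.subset_union_right) (isUpperSet_superset S) (dependsOnEdges_superset
        (Finset.subset_union_right.trans Finset.subset_union_right))
  · refine ⟨0, ?_⟩
    rintro _ ⟨E, rfl⟩
    exact rcProb_nonneg hp hq _ _
  · filter_upwards [eventually_ge_atTop E₀] with E hE
    rw [Finset.union_eq_left.2 hE]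

theorem measurableSpace_eq_generateFrom :
    (inferInstance : MeasurableSpace L.Config) = MeasurableSpace.generateFrom
      (Set.range fun S : Finset L.Edge => {ω : L.Config | (S : Set L.Edge) ⊆ ω}) := by
  apply le_antisymm
  · have : @Measurable _ _ (MeasurableSpace.generateFrom
        (Set.range fun S : Finset L.Edge => {ω : L.Config | (S : Set L.Edge) ⊆ ω})) _
        (id : L.Config → L.Config) := by
      refine (@measurable_set_iff _ _ (MeasurableSpace.generateFrom _) id).2 fun e => ?_
      refine (@measurableSet_setOfPred _ (MeasurableSpace.generateFrom _) _).1
        (MeasurableSpace.measurableSet_generateFrom ⟨{e}, ?_⟩)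
      simp
    intro A hA
    exact this hA
  · refine MeasurableSpace.generateFrom_le ?_
    rintro _ ⟨S, rfl⟩
    have : {ω : L.Config | (S : Set L.Edge) ⊆ ω} = ⋂ e ∈ S, {ω | e ∈ ω} := by
      ext ω
      simp [Set.subset_def]
    beta_reduce
    rw [this]
    exact Finset.measurableSet_biInter _ fun e _ => measurableSet_mem e

/-- These events form a generating π-system. They are also increasing, so stochastic comparisons
suffice to identify two measures. -/
theorem measure_ext_of_superset {φ ψ : Measure L.Config} [IsProbabilityMeasure φ]
    [IsProbabilityMeasure ψ] (h : ∀ S : Finset L.Edge, φ.real {ω | (S : Set L.Edge) ⊆ ω} =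
      ψ.real {ω | (S : Set L.Edge) ⊆ ω}) : φ = ψ := by
  classical
  refine ext_of_generate_finite _ measurableSpace_eq_generateFrom ?_ ?_ (by simp)
  · rintro _ ⟨S, rfl⟩ _ ⟨T, rfl⟩ -
    refine ⟨S ∪ T, ?_⟩
    ext ω
    simp
  · rintro _ ⟨S, rfl⟩
    exact (measureReal_eq_measureReal_iff (measure_ne_top _ _) (measure_ne_top _ _)).1 (h S)

/-! ### Absence of percolation and uniqueness, given decay in boxes. -/

/-- A walk that leaves the subgraph `E` meets its boundary. -/
theorem exists_boundary_of_walk {E : Finset L.Edge} {ω : L.Config} {u v : ℝ × ℝ}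
    (w : (openGraph ω).Walk u v) (hu : u ∈ vertices E) (hv : v ∈ vertices E → v ∈ boundary E) :
    ∃ b ∈ boundary E, (openGraph (ω ∩ E)).Reachable u b := by
  induction w with
  | nil => exact ⟨_, hv hu, SimpleGraph.Reachable.refl _⟩
  | @cons a b c hab _ ih =>
    by_cases ha : a ∈ boundary E
    · exact ⟨a, ha, SimpleGraph.Reachable.refl _⟩
    · obtain ⟨e, he, hev⟩ := openGraph_adj.1 hab
      have heE : e ∈ E := by
        by_contra h
        exact ha ⟨hu, e, h, by simp [hev]⟩
      obtain ⟨x, hx, hbx⟩ := ih ⟨e, heE, by simp [hev]⟩ hv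
      exact ⟨x, hx, (openGraph_adj.2 ⟨e, ⟨he, heE⟩, hev⟩ :
        (openGraph (ω ∩ E)).Adj a b).reachable.trans hbx⟩

/-- The event that `v` is connected to the boundary of `E`. -/
def toBoundary (E : Finset L.Edge) (v : ℝ × ℝ) : Set L.Config :=
  {ω | v ∈ boundaryCluster E ω}

theorem toBoundary_zero (E : Finset L.Edge) : toBoundary E 0 = zeroToBoundary E := by
  ext ω
  exact exists_congr fun b => and_congr_right fun _ => ⟨fun h => h.symm, fun h => h.symm⟩

theorem isUpperSet_toBoundary (E : Finset L.Edge) (v : ℝ × ℝ) : IsUpperSet (toBoundary E v) := by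
  rintro ω ω' h ⟨b, hb, hbv⟩
  exact ⟨b, hb, hbv.mono (openGraph_mono h)⟩

/-- Stopped at its first boundary vertex, a path from `v` uses only edges of `E`. -/
theorem dependsOnEdges_toBoundary {E : Finset L.Edge} {v : ℝ × ℝ} (hv : v ∈ vertices E) :
    DependsOnEdges (toBoundary E v) E := by
  suffices ∀ ω ω' : L.Config, (∀ e ∈ E, e ∈ ω ↔ e ∈ ω') → ω ∈ toBoundary E v →
      ω' ∈ toBoundary E v from
    fun ω ω' h => ⟨this ω ω' h, this ω' ω fun e he => (h e he).symm⟩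
  rintro ω ω' h ⟨b, hb, hbv⟩
  obtain ⟨w⟩ := hbv.symm
  obtain ⟨b', hb', h'⟩ := exists_boundary_of_walk w hv fun _ => hb
  exact ⟨b', hb', (h'.mono (openGraph_mono fun e he => (h e he.2).1 he.1)).symm⟩

theorem zeroToInfinity_subset (E : Finset L.Edge) (h0 : 0 ∈ vertices E) :
    L.zeroToInfinity ⊆ toBoundary E 0 := by
  intro ω hω
  obtain ⟨v, hv, hvE⟩ := hω.exists_notMem_finite (finite_vertices_finset E)
  obtain ⟨w⟩ := hv
  obtain ⟨b, hb, h⟩ := exists_boundary_of_walk w h0 fun h => (hvE h).elim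
  exact ⟨b, hb, (h.mono (openGraph_mono Set.inter_subset_left)).symm⟩

/-- An infinite cluster at `0` reaches the boundary of each box, and the infinite-volume wired
measure is dominated by the wired measure on the box for this increasing event. -/
theorem measure_zeroToInfinity_eq_zero (hp : p ∈ Set.Icc (0 : ℝ) 1) (hq : 1 ≤ q)
    (hdec : Tendsto (fun n => rcProb (wired (L.box n)) p q (toBoundary (L.box n) 0)) atTop (𝓝 0))
    {φ : Measure L.Config} (hφ : IsInfiniteVolumeMeasure wired p q φ) :
    φ L.zeroToInfinity = 0 := by
  have := hφ.1
  have h : ∀ n, φ.real L.zeroToInfinity ≤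
      rcProb (wired (L.box n)) p q (toBoundary (L.box n) 0) := by
    intro n
    have h0 := zero_mem_vertices_box (L := L) n
    refine (measureReal_mono (zeroToInfinity_subset _ h0)).trans ?_
    refine le_of_tendsto (hφ.2 (L.box n) _ (dependsOnEdges_toBoundary h0)) ?_
    filter_upwards [eventually_ge_atTop (L.box n)] with E hE
    exact rcProb_wired_anti hp hq hE (box_nonempty n) (isUpperSet_toBoundary _ _)
      (dependsOnEdges_toBoundary h0)
  have h1 := ge_of_tendsto' hdec h
  exact (measureReal_eq_zero_iff).1 (le_antisymm h1 measureReal_nonneg)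

/-- If the cluster of the boundary does not reach a given vertex, then the free and wired
infinite-volume measures coincide. -/
theorem eq_of_tendsto_toBoundary (hp : p ∈ Set.Icc (0 : ℝ) 1) (hq : 1 ≤ q)
    (hdec : ∀ v ∈ L.graph.support,
      Tendsto (fun n => rcProb (wired (L.box n)) p q (toBoundary (L.box n) v)) atTop (𝓝 0))
    {φ ψ : Measure L.Config} (hφ : IsInfiniteVolumeMeasure free p q φ)
    (hψ : IsInfiniteVolumeMeasure wired p q ψ) : φ = ψ := by
  have := hφ.1
  have := hψ.1
  refine measure_ext_of_superset fun S => ?_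
  have hA := isUpperSet_superset S
  have hAS := dependsOnEdges_superset (subset_refl S)
  have h0 := (hφ.2 S _ hAS).comp tendsto_box
  have h1 := (hψ.2 S _ hAS).comp tendsto_box
  refine le_antisymm (le_of_tendsto_of_tendsto' h0 h1 fun n => rcProb_free_le_wired hp hq _ hA) ?_
  have hV := finite_vertices_finset S
  have h2 : Tendsto (fun n => ∑ v ∈ hV.toFinset,
      rcProb (wired (L.box n)) p q (toBoundary (L.box n) v)) atTop (𝓝 0) := by
    rw [← Finset.sum_const_zero (s := hV.toFinset)]
    refine tendsto_finsetSum _ fun v hv => hdec v ?_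
    obtain ⟨e, _, h⟩ := hV.mem_toFinset.1 hv
    exact mem_support_of_mem h
  have h3 := h0.add h2
  rw [add_zero] at h3
  refine le_of_tendsto_of_tendsto h1 h3 ?_
  filter_upwards [tendsto_box.eventually (eventually_ge_atTop S)] with n hn
  -- Either the boundary cluster misses `S`, and the free measure dominates, or it reaches one of
  -- the finitely many vertices of `S`.
  refine (rcProb_mono hp hq _ (B := {ω | (S : Set L.Edge) ⊆ ω} ∩ notToBoundary (L.box n) S ∪
    ⋃ v ∈ hV.toFinset, toBoundary (L.box n) v) ?_).trans ((rcProb_union_le hp hq _ _ _).trans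
    (add_le_add (rcProb_wired_inter_notToBoundary_le hp hq hn hA hAS)
      (rcProb_biUnion_le hp hq _ _ _)))
  intro ω _ hω
  by_cases h : (ω : Set L.Edge) ∈ notToBoundary (L.box n) S
  · exact Or.inl ⟨hω, h⟩
  · simp only [notToBoundary, Set.mem_ofPred_eq, not_forall, not_not] at h
    obtain ⟨e, he, v, hv, hvC⟩ := h
    exact Or.inr (Set.mem_biUnion (hV.mem_toFinset.2 ⟨e, he, hv⟩) hvC)

end PlanarLattice

/-! ### Invariance under automorphisms of the lattice. -/

theorem SimpleGraph.ncc_image {X : Type*} (σ : X ≃ X) {G H : SimpleGraph X}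
    (h : ∀ u v, H.Adj (σ u) (σ v) ↔ G.Adj u v) (V : Set X) : ncc (σ '' V) H = ncc V G := by
  let f : G.induce V ≃g H.induce (σ '' V) :=
    { toEquiv := σ.image V
      map_rel_iff' := fun {a b} => h a b }
  exact (Nat.card_congr f.connectedComponentEquiv).symm

namespace PlanarLattice

variable {L : PlanarLattice} {p q : ℝ}

section symmetry

variable (σ : L.graph ≃g L.graph)

theorem mem_mapEdgeSet {e : L.Edge} {v : ℝ × ℝ} :
    σ v ∈ (σ.mapEdgeSet e : Sym2 (ℝ × ℝ)) ↔ v ∈ (e : Sym2 (ℝ × ℝ)) := by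
  change σ v ∈ Sym2.map σ (e : Sym2 (ℝ × ℝ)) ↔ _
  rw [Sym2.mem_map]
  constructor
  · rintro ⟨a, ha, h⟩
    rwa [← σ.injective h]
  · exact fun h => ⟨v, h, rfl⟩

theorem mem_mapEdgeSet' {e : L.Edge} {v : ℝ × ℝ} :
    v ∈ (σ.mapEdgeSet e : Sym2 (ℝ × ℝ)) ↔ σ.symm v ∈ (e : Sym2 (ℝ × ℝ)) := by
  have := mem_mapEdgeSet σ (e := e) (v := σ.symm v)
  rwa [RelIso.apply_symm_apply] at this

/-- The image of a finite subgraph under an automorphism. -/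
noncomputable def mapEdges (E : Finset L.Edge) : Finset L.Edge := E.map σ.mapEdgeSet.toEmbedding

theorem mem_mapEdges {E : Finset L.Edge} {e : L.Edge} :
    σ.mapEdgeSet e ∈ mapEdges σ E ↔ e ∈ E :=
  Finset.mem_map' _

theorem coe_mapEdges (E : Finset L.Edge) :
    ((mapEdges σ E : Finset L.Edge) : Set L.Edge) = σ.mapEdgeSet '' E := by
  simp [mapEdges]

theorem openGraph_image_adj {ω : L.Config} {u v : ℝ × ℝ} :
    (openGraph (σ.mapEdgeSet '' ω)).Adj (σ u) (σ v) ↔ (openGraph ω).Adj u v := by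
  simp only [openGraph_adj, Set.exists_mem_image]
  refine exists_congr fun e => and_congr_right fun _ => ?_
  change Sym2.map σ (e : Sym2 (ℝ × ℝ)) = Sym2.map σ s(u, v) ↔ _
  exact (Sym2.map.injective σ.injective).eq_iff

theorem vertices_mapEdges (E : Finset L.Edge) :
    vertices (mapEdges σ E) = σ.toEquiv '' vertices E := by
  ext v
  rw [Equiv.image_eq_preimage_symm]
  constructor
  · rintro ⟨e, he, hv⟩
    obtain ⟨f, rfl⟩ := σ.mapEdgeSet.surjective e
    exact ⟨f, (mem_mapEdges σ).1 he, (mem_mapEdgeSet' σ).1 hv⟩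
  · rintro ⟨e, he, hv⟩
    exact ⟨_, (mem_mapEdges σ).2 he, (mem_mapEdgeSet' σ).2 hv⟩

theorem boundary_mapEdges (E : Finset L.Edge) :
    boundary (mapEdges σ E) = σ.toEquiv '' boundary E := by
  ext v
  have hV : v ∈ vertices (mapEdges σ E) ↔ σ.symm v ∈ vertices E := by
    rw [vertices_mapEdges, Equiv.image_eq_preimage_symm]
    rfl
  rw [Equiv.image_eq_preimage_symm]
  constructor
  · rintro ⟨hv, e, he, hve⟩
    obtain ⟨f, rfl⟩ := σ.mapEdgeSet.surjective e
    exact ⟨hV.1 hv, f, fun h => he ((mem_mapEdges σ).2 h), (mem_mapEdgeSet' σ).1 hve⟩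
  · rintro ⟨hv, e, he, hve⟩
    exact ⟨hV.2 hv, σ.mapEdgeSet e, fun h => he ((mem_mapEdges σ).1 h), (mem_mapEdgeSet' σ).2 hve⟩

theorem numClusters_mapEdges (E ω : Finset L.Edge) :
    numClusters (wired (mapEdges σ E)) (mapEdges σ ω : Set L.Edge) =
      numClusters (wired E) (ω : Set L.Edge) := by
  rw [numClusters_wired, numClusters_wired, vertices_mapEdges, boundary_mapEdges, coe_mapEdges]
  refine SimpleGraph.ncc_image σ.toEquiv (fun u v => ?_) _
  simp only [SimpleGraph.sup_adj, SimpleGraph.completeOn_adj, Equiv.injective,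
    Function.Injective.mem_set_image, ne_eq, EmbeddingLike.apply_eq_iff_eq]
  exact or_congr (openGraph_image_adj σ) Iff.rfl

theorem weight_mapEdges (E ω : Finset L.Edge) :
    weight (wired (mapEdges σ E)) p q (mapEdges σ ω) = weight (wired E) p q ω := by
  rw [weight, weight, numClusters_mapEdges]
  simp [mapEdges]

/-- Invariance of the random-cluster measures under automorphisms of the lattice. -/
theorem rcProb_mapEdges (E : Finset L.Edge) (A : Set L.Config) :
    rcProb (wired (mapEdges σ E)) p q A =
      rcProb (wired E) p q {ω | σ.mapEdgeSet '' ω ∈ A} := by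
  classical
  have key : ∀ f : Finset L.Edge → ℝ,
      ∑ ω ∈ (mapEdges σ E).powerset, f ω = ∑ ω ∈ E.powerset, f (mapEdges σ ω) := by
    intro f
    symm
    refine Finset.sum_bij (fun ω _ => mapEdges σ ω) ?_ ?_ ?_ fun _ _ => rfl
    · intro ω hω
      exact Finset.mem_powerset.2 (Finset.map_subset_map.2 (Finset.mem_powerset.1 hω))
    · intro ω _ ω' _ h
      exact Finset.map_injective _ h
    · intro ω hω
      obtain ⟨ω', h, rfl⟩ := Finset.subset_map_iff.1 (Finset.mem_powerset.1 hω)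
      exact ⟨ω', Finset.mem_powerset.2 h, rfl⟩
  simp only [rcProb_eq_wsum, wsum_univ]
  simp only [wsum_eq_sum_ite, key, weight_mapEdges, coe_mapEdges]
  rfl

/-- The event that `u` and `v` are connected by open edges of `B`. -/
def connIn (B : Finset L.Edge) (u v : ℝ × ℝ) : Set L.Config :=
  {ω | (openGraph (ω ∩ B)).Reachable u v}

theorem isUpperSet_connIn (B : Finset L.Edge) (u v : ℝ × ℝ) : IsUpperSet (connIn B u v) :=
  fun _ _ h h' => h'.mono (openGraph_mono (Set.inter_subset_inter_left _ h))

theorem dependsOnEdges_connIn {B E : Finset L.Edge} (h : B ⊆ E) (u v : ℝ × ℝ) :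
    DependsOnEdges (connIn B u v) E := by
  intro ω ω' hω
  have : ω ∩ (B : Set L.Edge) = ω' ∩ B := by
    ext e
    simp only [Set.mem_inter_iff, Finset.mem_coe]
    exact ⟨fun h' => ⟨(hω e (h h'.2)).1 h'.1, h'.2⟩, fun h' => ⟨(hω e (h h'.2)).2 h'.1, h'.2⟩⟩
  simp [connIn, this]

theorem rcProb_connIn_mapEdges (E B : Finset L.Edge) (u v : ℝ × ℝ) :
    rcProb (wired (mapEdges σ E)) p q (connIn (mapEdges σ B) (σ u) (σ v)) =
      rcProb (wired E) p q (connIn B u v) := by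
  rw [rcProb_mapEdges]
  congr 1
  ext ω
  simp only [connIn, Set.mem_ofPred_eq, coe_mapEdges]
  rw [← Set.image_inter σ.mapEdgeSet.injective]
  let f : openGraph (ω ∩ B) ≃g openGraph (σ.mapEdgeSet '' (ω ∩ B)) :=
    { toEquiv := σ.toEquiv
      map_rel_iff' := openGraph_image_adj σ }
  exact f.reachable_iff

end symmetry

/-- The translations of the lattice. -/
def translateIso (L : PlanarLattice) (z : ℤ × ℤ) : L.graph ≃g L.graph where
  toEquiv := Equiv.addRight ((z.1 : ℝ), (z.2 : ℝ))
  map_rel_iff' := fun {u v} => L.adj_translate z.1 z.2 u v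

/-- The rotation of the lattice. -/
def rotateIso (L : PlanarLattice) : L.graph ≃g L.graph where
  toFun u := (-u.2, u.1)
  invFun u := (u.2, -u.1)
  left_inv u := by simp
  right_inv u := by simp
  map_rel_iff' := fun {u v} => L.adj_rotate u v

theorem mem_box_norm {n : ℕ} {e : L.Edge} :
    e ∈ L.box n ↔ ∃ v ∈ (e : Sym2 (ℝ × ℝ)), ‖v‖ ≤ n := by
  rw [mem_box]
  refine exists_congr fun v => and_congr_right fun _ => ?_
  rw [Prod.norm_def, max_le_iff, Real.norm_eq_abs, Real.norm_eq_abs, abs_le, abs_le]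
  rfl

/-- The translate by `z` of the box of size `n`. -/
noncomputable def boxAt (L : PlanarLattice) (z : ℤ × ℤ) (n : ℕ) : Finset L.Edge :=
  mapEdges (L.translateIso z) (L.box n)

theorem mem_boxAt {z : ℤ × ℤ} {n : ℕ} {e : L.Edge} :
    e ∈ L.boxAt z n ↔ ∃ v ∈ (e : Sym2 (ℝ × ℝ)), ‖v - ((z.1 : ℝ), (z.2 : ℝ))‖ ≤ n := by
  obtain ⟨f, rfl⟩ := (L.translateIso z).mapEdgeSet.surjective e
  rw [boxAt, mem_mapEdges, mem_box_norm]
  constructor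
  · rintro ⟨v, hv, h⟩
    refine ⟨_, (mem_mapEdgeSet (L.translateIso z)).2 hv, ?_⟩
    change ‖v + ((z.1 : ℝ), (z.2 : ℝ)) - ((z.1 : ℝ), (z.2 : ℝ))‖ ≤ n
    rwa [add_sub_cancel_right]
  · rintro ⟨v, hv, h⟩
    refine ⟨_, (mem_mapEdgeSet' (L.translateIso z)).1 hv, ?_⟩
    change ‖v + -((z.1 : ℝ), (z.2 : ℝ))‖ ≤ n
    rwa [← sub_eq_add_neg]

theorem mapEdges_rotate_box (n : ℕ) : mapEdges L.rotateIso (L.box n) = L.box n := by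
  ext e
  obtain ⟨f, rfl⟩ := L.rotateIso.mapEdgeSet.surjective e
  rw [mem_mapEdges, mem_box_norm, mem_box_norm]
  constructor
  · rintro ⟨v, hv, h⟩
    refine ⟨_, (mem_mapEdgeSet L.rotateIso).2 hv, ?_⟩
    simpa [rotateIso, Prod.norm_def, max_comm] using h
  · rintro ⟨v, hv, h⟩
    refine ⟨_, (mem_mapEdgeSet' L.rotateIso).1 hv, ?_⟩
    have : L.rotateIso.symm v = (v.2, -v.1) := rfl
    simpa [this, Prod.norm_def, max_comm] using h

/-! ### Finite energy: the cost of opening given edges. -/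

section insertion

/-- Two endpoints form one or two components. -/
theorem ncc_vertices_singleton_le (e : L.Edge) (G H : SimpleGraph (ℝ × ℝ)) :
    SimpleGraph.ncc (vertices {e}) G ≤ SimpleGraph.ncc (vertices {e}) H + 1 := by
  have hV : vertices {e} = {v | v ∈ (e : Sym2 (ℝ × ℝ))} := by
    ext v
    simp [vertices]
  have hfin := (finite_vertices_finset ({e} : Finset L.Edge))
  have := hfin.to_subtype
  have h1 : SimpleGraph.ncc (vertices {e}) G ≤ 2 := by
    refine (Nat.card_le_card_of_surjective (G.induce (vertices {e})).connectedComponentMk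
      Quot.mk_surjective).trans ?_
    rw [hV]
    obtain ⟨⟨x, y⟩, hxy⟩ := Quot.exists_rep (e : Sym2 (ℝ × ℝ))
    have h2 : {v | v ∈ (e : Sym2 (ℝ × ℝ))} = {x, y} := by
      ext v
      rw [← hxy]
      exact Sym2.mem_iff
    rw [h2, Nat.card_coe_set_eq]
    exact (Set.ncard_insert_le x {y}).trans (by simp)
  have h2 : 0 < SimpleGraph.ncc (vertices {e}) H := by
    have := SimpleGraph.finite_components hfin H
    have : Nonempty (H.induce (vertices {e})).ConnectedComponent :=
      ⟨(H.induce (vertices {e})).connectedComponentMk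
        ⟨_, e, Finset.mem_singleton_self e, Sym2.out_fst_mem _⟩⟩
    exact Nat.card_pos
  omega

/-- An edge is open with probability at least `p / q`. -/
theorem le_rcProb_mem (hp : p ∈ Set.Icc (0 : ℝ) 1) (hq : 1 ≤ q) {E : Finset L.Edge} {e : L.Edge}
    (he : e ∈ E) : p / q ≤ rcProb (wired E) p q {ω | e ∈ ω} := by
  classical
  have hA : IsUpperSet {ω : L.Config | e ∈ ω} := fun _ _ h h' => h h'
  -- The free measure on the single edge `e` gives a lower bound, and it can be computed.
  refine le_trans ?_ ((rcProb_free_mono hp hq (Finset.singleton_subset_iff.2 he) hA).trans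
    (rcProb_free_le_wired hp hq E hA))
  have hq0 : 0 < q := zero_lt_one.trans_le hq
  have hpow : ({e} : Finset L.Edge).powerset = {∅, {e}} := by
    ext s
    simp [Finset.subset_singleton_iff]
  have hne : (∅ : Finset L.Edge) ≠ {e} := (Finset.singleton_ne_empty e).symm
  rw [rcProb_eq_wsum, div_le_div_iff₀ hq0 (wsum_univ_pos hp hq _)]
  rw [wsum_univ, wsum_eq_sum_ite, hpow, Finset.sum_pair hne,
    Finset.sum_pair hne]
  simp only [Finset.coe_empty, Set.mem_ofPred_eq, Set.mem_empty_iff_false, if_false,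
    Finset.coe_singleton, Set.mem_singleton_iff, if_true, zero_add]
  simp only [weight, Finset.card_singleton, Finset.card_empty, pow_zero, pow_one, one_mul,
    Nat.sub_zero, Nat.sub_self, mul_one]
  rw [numClusters_free, numClusters_free]
  set k₀ := SimpleGraph.ncc (vertices {e}) (openGraph ((∅ : Finset L.Edge) : Set L.Edge))
  set k₁ := SimpleGraph.ncc (vertices {e}) (openGraph (({e} : Finset L.Edge) : Set L.Edge))
  have h0 : q ^ k₀ ≤ q ^ (k₁ + 1) := pow_le_pow_right₀ hq (ncc_vertices_singleton_le e _ _)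
  have h1 : q ^ k₁ ≤ q ^ (k₁ + 1) := pow_le_pow_right₀ hq (Nat.le_succ _)
  have hp1 : 0 ≤ 1 - p := sub_nonneg.2 hp.2
  calc p * ((1 - p) * q ^ k₀ + p * q ^ k₁)
      ≤ p * ((1 - p) * q ^ (k₁ + 1) + p * q ^ (k₁ + 1)) := by
        have := hp.1
        gcongr
    _ = p * q ^ k₁ * q := by ring

/-- Positive association multiplies the bounds for single edges. -/
theorem pow_le_rcProb_superset (hp : p ∈ Set.Icc (0 : ℝ) 1) (hq : 1 ≤ q) {E F : Finset L.Edge}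
    (hF : F ⊆ E) : (p / q) ^ F.card ≤ rcProb (wired E) p q {ω | (F : Set L.Edge) ⊆ ω} := by
  classical
  have hp0 := hp.1
  have hq0 : 0 < q := zero_lt_one.trans_le hq
  induction F using Finset.induction_on with
  | empty =>
    simp only [Finset.card_empty, pow_zero, Finset.coe_empty, Set.empty_subset]
    rw [rcProb_eq_wsum, show {ω : L.Config | True} = Set.univ from rfl,
      div_self (wsum_univ_pos hp hq _).ne']
  | insert e F he ih =>
    rw [Finset.insert_subset_iff] at hF
    rw [Finset.card_insert_of_notMem he, pow_succ]
    have h1 := ih hF.2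
    have h2 := le_rcProb_mem hp hq hF.1
    have h3 : {ω : L.Config | ((insert e F : Finset L.Edge) : Set L.Edge) ⊆ ω} =
        {ω | (F : Set L.Edge) ⊆ ω} ∩ {ω | e ∈ ω} := by
      ext ω
      simp [Set.insert_subset_iff, and_comm]
    rw [h3]
    exact (mul_le_mul h1 h2 (by positivity) (rcProb_nonneg hp hq _ _)).trans
      (rcProb_mul_le hp hq E (isUpperSet_superset F) fun _ _ h h' => h h')

/-- Connecting with open edges costs at most a factor depending on the number of edges. -/
theorem pow_mul_rcProb_le (hp : p ∈ Set.Icc (0 : ℝ) 1) (hq : 1 ≤ q) {E F : Finset L.Edge}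
    (hF : F ⊆ E) {A B : Set L.Config} (hA : IsUpperSet A)
    (hAB : ∀ ω ∈ A, (F : Set L.Edge) ⊆ ω → ω ∈ B) :
    (p / q) ^ F.card * rcProb (wired E) p q A ≤ rcProb (wired E) p q B :=
  calc _ ≤ rcProb (wired E) p q {ω | (F : Set L.Edge) ⊆ ω} * rcProb (wired E) p q A :=
        mul_le_mul_of_nonneg_right (pow_le_rcProb_superset hp hq hF) (rcProb_nonneg hp hq _ _)
    _ ≤ _ := rcProb_mul_le hp hq E (isUpperSet_superset F) hA
    _ ≤ _ := rcProb_mono hp hq _ fun _ _ h => hAB _ h.2 h.1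

end insertion

end PlanarLattice

/-! ### Periodic paths, and extension of connections to the sides of a box. -/

/-- The first exit of a walk from a set. -/
theorem SimpleGraph.Walk.exists_exit {X : Type*} {G : SimpleGraph X} (S : Set X) {a b : X}
    (w : G.Walk a b) (ha : a ∈ S) (hb : b ∉ S) :
    ∃ s ∈ S, ∃ t ∉ S, G.Adj s t ∧ ∃ w' : G.Walk a s, ∀ x ∈ w'.support, x ∈ S := by
  induction w with
  | nil => exact (hb ha).elim
  | @cons a c b h _ ih =>
    by_cases hc : c ∈ S
    · obtain ⟨s, hs, t, ht, hst, w', hw'⟩ := ih hc hb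
      refine ⟨s, hs, t, ht, hst, SimpleGraph.Walk.cons h w', fun x hx => ?_⟩
      rw [SimpleGraph.Walk.support_cons, List.mem_cons] at hx
      rcases hx with rfl | hx
      exacts [ha, hw' x hx]
    · refine ⟨a, ha, c, hc, h, SimpleGraph.Walk.nil, fun x hx => ?_⟩
      rw [SimpleGraph.Walk.support_nil, List.mem_singleton] at hx
      rwa [hx]

namespace PlanarLattice

variable {L : PlanarLattice} {p q : ℝ}

/-- A box contains every edge with one endpoint in it, so a walk whose vertices lie in the square is
a connection inside the box. -/
theorem reachable_of_mem_support {ω B : L.Config} {a b : ℝ × ℝ} (w : (openGraph ω).Walk a b)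
    (hB : ∀ e ∈ ω, ∀ x ∈ (e : Sym2 (ℝ × ℝ)), x ∈ w.support → e ∈ B) {x : ℝ × ℝ}
    (hx : x ∈ w.support) : (openGraph (ω ∩ B)).Reachable a x := by
  induction w with
  | nil =>
    rw [SimpleGraph.Walk.support_nil, List.mem_singleton] at hx
    rw [hx]
  | @cons a c b h w ih =>
    rw [SimpleGraph.Walk.support_cons, List.mem_cons] at hx
    rcases hx with rfl | hx
    · exact SimpleGraph.Reachable.refl _
    · obtain ⟨e, he, hev⟩ := openGraph_adj.1 h
      have heB : e ∈ B := hB e he a (by simp [hev]) (by simp)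
      exact (openGraph_adj.2 ⟨e, ⟨he, heB⟩, hev⟩ :
        (openGraph (ω ∩ B)).Adj a c).reachable.trans
        (ih (fun f hf y hy hy' => hB f hf y hy (by simp [hy'])) hx)

theorem adj_of_openGraph_adj {ω : L.Config} {u v : ℝ × ℝ} (h : (openGraph ω).Adj u v) :
    L.graph.Adj u v := by
  obtain ⟨e, _, hev⟩ := openGraph_adj.1 h
  have := e.2
  rwa [hev, SimpleGraph.mem_edgeSet] at this

/-- The integer part of a point, as a vector. -/
noncomputable def floorPt (u : ℝ × ℝ) : ℤ × ℤ := (⌊u.1⌋, ⌊u.2⌋)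

theorem sub_floorPt_mem (u : ℝ × ℝ) :
    u - (((floorPt u).1 : ℝ), ((floorPt u).2 : ℝ)) ∈ Set.Icc (0 : ℝ) 1 ×ˢ Set.Icc (0 : ℝ) 1 := by
  have h1 := Int.floor_le u.1
  have h2 := Int.lt_floor_add_one u.1
  have h3 := Int.floor_le u.2
  have h4 := Int.lt_floor_add_one u.2
  refine ⟨⟨?_, ?_⟩, ⟨?_, ?_⟩⟩ <;> simp only [floorPt, Prod.fst_sub, Prod.snd_sub] <;> linarith

theorem mem_support_sub (z : ℤ × ℤ) {u : ℝ × ℝ} (hu : u ∈ L.graph.support) :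
    u - ((z.1 : ℝ), (z.2 : ℝ)) ∈ L.graph.support := by
  rw [← mem_support_translate z.1 z.2]
  simpa using hu

/-- Every vertex has an integer translate in this finite set, so bounds at single vertices become
uniform over the lattice. -/
theorem finite_cell (L : PlanarLattice) :
    (Set.Icc (0 : ℝ) 1 ×ˢ Set.Icc (0 : ℝ) 1 ∩ L.graph.support).Finite :=
  L.finite_vertices _ ((Metric.isBounded_Icc _ _).prod (Metric.isBounded_Icc _ _))

theorem arc_isPreconnected {u v : ℝ × ℝ} (h : L.graph.Adj u v) :
    IsPreconnected (L.arc s(u, v)) ∧ IsCompact (L.arc s(u, v)) ∧ u ∈ L.arc s(u, v) ∧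
      v ∈ L.arc s(u, v) := by
  obtain ⟨γ, -, hγ⟩ := L.arc_simple u v h
  rw [hγ]
  exact ⟨isPreconnected_range γ.continuous, isCompact_range γ.continuous, ⟨0, γ.source⟩,
    ⟨1, γ.target⟩⟩

/-- The drawings of the edges have uniformly bounded size. -/
theorem exists_arc_bound (L : PlanarLattice) :
    ∃ R : ℝ, 0 ≤ R ∧ ∀ u v, L.graph.Adj u v → ∀ x ∈ L.arc s(u, v), ‖x - u‖ ≤ R := by
  have hfin := L.finite_rectEdges 0 1 0 1
  have hb : Bornology.IsBounded (⋃ e ∈ L.rectEdges 0 1 0 1, L.arc e) := by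
    rw [Bornology.isBounded_biUnion hfin]
    rintro ⟨e, he⟩ -
    induction e using Sym2.ind with
    | h x y => exact (arc_isPreconnected he).2.1.isBounded
  obtain ⟨r, hr⟩ := hb.exists_norm_le
  have key : ∀ u ∈ Set.Icc (0 : ℝ) 1 ×ˢ Set.Icc (0 : ℝ) 1, ∀ v, L.graph.Adj u v →
      ∀ x ∈ L.arc s(u, v), ‖x - u‖ ≤ |r| + 1 := by
    intro u hu v huv x hx
    have h1 : ‖x‖ ≤ r := hr x (Set.mem_biUnion (x := (⟨s(u, v), huv⟩ : L.Edge))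
      ⟨u, by simp, hu⟩ hx)
    have h2 : ‖u‖ ≤ 1 := by
      rw [Prod.norm_def, max_le_iff, Real.norm_eq_abs, Real.norm_eq_abs, abs_le, abs_le]
      have := hu.1.1; have := hu.1.2; have := hu.2.1; have := hu.2.2
      exact ⟨⟨by linarith, by linarith⟩, ⟨by linarith, by linarith⟩⟩
    calc ‖x - u‖ ≤ ‖x‖ + ‖u‖ := norm_sub_le x u
      _ ≤ |r| + 1 := add_le_add (h1.trans (le_abs_self r)) h2
  refine ⟨|r| + 1, by positivity, fun u v huv x hx => ?_⟩
  set z : ℝ × ℝ := (((floorPt u).1 : ℝ), ((floorPt u).2 : ℝ)) with hz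
  have huv' : L.graph.Adj (u - z) (v - z) := by
    rw [← L.adj_translate (floorPt u).1 (floorPt u).2]
    simpa [hz] using huv
  have harc := L.arc_translate (floorPt u).1 (floorPt u).2 s(u - z, v - z) huv'
  rw [Sym2.map_mk, ← hz, sub_add_cancel, sub_add_cancel] at harc
  rw [harc] at hx
  obtain ⟨y, hy, rfl⟩ := hx
  have := key _ (sub_floorPt_mem u) _ huv' y hy
  rwa [show y + z - u = y - (u - z) by abel]

theorem exists_edges_of_reachable {u v : ℝ × ℝ} (h : L.graph.Reachable u v) :
    ∃ F : Finset L.Edge, (openGraph (F : Set L.Edge)).Reachable u v := by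
  classical
  obtain ⟨w⟩ := h
  induction w with
  | nil => exact ⟨∅, SimpleGraph.Reachable.refl _⟩
  | @cons a b c hab _ ih =>
    obtain ⟨F, hF⟩ := ih
    refine ⟨insert ⟨s(a, b), hab⟩ F, ?_⟩
    refine SimpleGraph.Reachable.trans (v := b) ?_ (hF.mono (openGraph_mono (by simp)))
    exact (openGraph_adj.2 ⟨⟨s(a, b), hab⟩, by simp, rfl⟩).reachable

theorem reachable_mapEdges (σ : L.graph ≃g L.graph) {F : Finset L.Edge} {u v : ℝ × ℝ}
    (h : (openGraph (F : Set L.Edge)).Reachable u v) :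
    (openGraph (mapEdges σ F : Set L.Edge)).Reachable (σ u) (σ v) := by
  rw [coe_mapEdges]
  let f : openGraph (F : Set L.Edge) ≃g openGraph (σ.mapEdgeSet '' F) :=
    { toEquiv := σ.toEquiv
      map_rel_iff' := openGraph_image_adj σ }
  exact f.reachable_iff.2 h

/-- A vertex is joined to its translate by a path of bounded length. -/
theorem exists_step (L : PlanarLattice) (d : ℤ) : ∃ N : ℕ, ∀ u ∈ L.graph.support,
    ∃ F : Finset L.Edge, F.card ≤ N ∧ (∀ e ∈ F, ∀ w ∈ (e : Sym2 (ℝ × ℝ)), ‖w - u‖ ≤ N) ∧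
      (openGraph (F : Set L.Edge)).Reachable u (u + ((d : ℝ), 0)) := by
  -- Stated for all points, vacuously off the support, so that `choose` yields a function; `N` is
  -- its supremum over the unit cell.
  have h1 : ∀ u : ℝ × ℝ, ∃ n : ℕ, u ∈ L.graph.support → ∃ F : Finset L.Edge, F.card ≤ n ∧
      (∀ e ∈ F, ∀ w ∈ (e : Sym2 (ℝ × ℝ)), ‖w - u‖ ≤ n) ∧
      (openGraph (F : Set L.Edge)).Reachable u (u + ((d : ℝ), 0)) := by
    intro u
    by_cases hu : u ∈ L.graph.support
    · have hu' : u + ((d : ℝ), 0) ∈ L.graph.support := by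
        have := (mem_support_translate (L := L) d 0).2 hu
        simpa using this
      obtain ⟨F, hF⟩ := exists_edges_of_reachable (L.connected _ hu _ hu')
      have hb : Bornology.IsBounded ((fun w => w - u) '' vertices F) :=
        ((finite_vertices_finset F).image _).isBounded
      obtain ⟨r, hr⟩ := hb.exists_norm_le
      obtain ⟨n, hn⟩ := exists_nat_ge r
      refine ⟨max F.card n, fun _ => ⟨F, le_max_left _ _, fun e he w hw => ?_, hF⟩⟩
      have := hr _ ⟨w, ⟨e, he, hw⟩, rfl⟩
      push_cast
      exact this.trans (hn.trans (le_max_right _ _))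
    · exact ⟨0, fun h => (hu h).elim⟩
  choose n hn using h1
  refine ⟨(finite_cell L).toFinset.sup n, fun u hu => ?_⟩
  set z : ℝ × ℝ := (((floorPt u).1 : ℝ), ((floorPt u).2 : ℝ)) with hz
  have hu' : u - z ∈ L.graph.support := mem_support_sub _ hu
  have hle : n (u - z) ≤ (finite_cell L).toFinset.sup n :=
    Finset.le_sup (f := n) ((finite_cell L).mem_toFinset.2 ⟨sub_floorPt_mem u, hu'⟩)
  obtain ⟨F, hF1, hF2, hF3⟩ := hn (u - z) hu'
  refine ⟨mapEdges (L.translateIso (floorPt u)) F, ?_, ?_, ?_⟩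
  · rw [mapEdges, Finset.card_map]
    exact hF1.trans hle
  · intro e he w hw
    obtain ⟨f, rfl⟩ := (L.translateIso (floorPt u)).mapEdgeSet.surjective e
    have := hF2 f ((mem_mapEdges _).1 he) _ ((mem_mapEdgeSet' _).1 hw)
    change ‖w + -z - (u - z)‖ ≤ _ at this
    rw [show w + -z - (u - z) = w - u by abel] at this
    exact this.trans (by exact_mod_cast hle)
  · have := reachable_mapEdges (L.translateIso (floorPt u)) hF3
    change (openGraph _).Reachable (u - z + z) (u - z + ((d : ℝ), 0) + z) at this
    rwa [show u - z + ((d : ℝ), 0) + z = u + ((d : ℝ), 0) by abel, sub_add_cancel] at this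

/-- A nearly straight horizontal path, made of translates of one path. -/
theorem exists_straight (L : PlanarLattice) (d : ℤ) (hd : d = 1 ∨ d = -1) : ∃ N : ℕ, ∀ j : ℕ,
    ∀ u ∈ L.graph.support, ∃ F : Finset L.Edge, F.card ≤ j * N ∧
      (∀ e ∈ F, ∀ w ∈ (e : Sym2 (ℝ × ℝ)), |w.2 - u.2| ≤ N ∧ -N ≤ d * (w.1 - u.1) ∧
        d * (w.1 - u.1) ≤ j + N) ∧
      (openGraph (F : Set L.Edge)).Reachable u (u + ((j * d : ℝ), 0)) := by
  classical
  obtain ⟨N, hN⟩ := exists_step L d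
  refine ⟨N, fun j => ?_⟩
  induction j with
  | zero => exact fun u _ => ⟨∅, by simp, by simp, by simp [show ((0 : ℝ), (0 : ℝ)) = 0 from rfl]⟩
  | succ j ih =>
    intro u hu
    obtain ⟨F, hF1, hF2, hF3⟩ := ih u hu
    have hu' : u + ((j * d : ℝ), 0) ∈ L.graph.support := by
      have := (mem_support_translate (L := L) (j * d) 0).2 hu
      simpa using this
    obtain ⟨F', hF1', hF2', hF3'⟩ := hN _ hu'
    refine ⟨F ∪ F', ?_, ?_, ?_⟩
    · refine (Finset.card_union_le _ _).trans ?_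
      rw [add_mul, one_mul]
      exact add_le_add hF1 hF1'
    · intro e he w hw
      rcases Finset.mem_union.1 he with he | he
      · obtain ⟨h1, h2, h3⟩ := hF2 e he w hw
        refine ⟨h1, h2, ?_⟩
        push_cast
        linarith
      · have h := hF2' e he w hw
        rw [Prod.norm_def, max_le_iff, Real.norm_eq_abs, Real.norm_eq_abs, abs_le] at h
        simp only [Prod.fst_sub, Prod.snd_sub, Prod.fst_add, Prod.snd_add, add_zero] at h
        have hj : (0 : ℝ) ≤ j := Nat.cast_nonneg j
        refine ⟨h.2, ?_⟩
        push_cast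
        rcases hd with rfl | rfl <;> push_cast at h ⊢ <;>
          exact ⟨by linarith [h.1.1, h.1.2], by linarith [h.1.1, h.1.2]⟩
    · refine (hF3.mono (openGraph_mono (by simp))).trans ?_
      have := hF3'.mono (openGraph_mono (L := L)
        (show ((F' : Finset L.Edge) : Set L.Edge) ⊆ ((F ∪ F' : Finset L.Edge) : Set L.Edge) by simp))
      have h : u + ((j * d : ℝ), 0) + ((d : ℝ), 0) = u + (((j + 1 : ℕ) : ℝ) * d, 0) := by
        ext
        · simp only [Prod.fst_add]
          push_cast
          ring
        · simp
      rwa [h] at this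

/-- A vertex close to the left or right side of a box can be joined to this side using a bounded
number of edges. -/
theorem exists_extension (L : PlanarLattice) (d : ℤ) (hd : d = 1 ∨ d = -1) :
    ∃ K₀ : ℕ, ∀ K ≥ K₀, ∃ N : ℕ, ∀ m : ℕ, 2 * K + 2 ≤ m → ∀ u ∈ L.graph.support,
      d * u.1 ≤ m → (m : ℝ) - K - 2 ≤ d * u.1 → |u.2| ≤ (m : ℝ) - K + 1 →
      ∃ F ⊆ L.box m, F.card ≤ N ∧ ∃ s t, ∃ e ∈ F, (e : Sym2 (ℝ × ℝ)) = s(s, t) ∧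
        (openGraph (F : Set L.Edge)).Reachable u s ∧
        (L.arc e ∩ {(d * m : ℝ)} ×ˢ Set.Icc (-m : ℝ) m).Nonempty := by
  classical
  obtain ⟨R, hR0, hR⟩ := exists_arc_bound L
  obtain ⟨N, hN⟩ := exists_straight L d hd
  obtain ⟨R', hR'⟩ := exists_nat_ge R
  -- The path drifts vertically by at most `N` and the drawing of its last edge by `R'` more, so `K
  -- ≥ R' + N + 1` keeps both within height `m`. Since `u` is within `K + 2` of the side, `K + 3`
  -- unit steps pass beyond it.
  refine ⟨R' + N + 1, fun K hK => ⟨(K + 3) * N, fun m hm u hu hum hu1 hu2 => ?_⟩⟩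
  have hK' : (R' : ℝ) + N + 1 ≤ K := by exact_mod_cast hK
  have hm' : 2 * (K : ℝ) + 2 ≤ m := by exact_mod_cast hm
  obtain ⟨F, hF1, hF2, ⟨w⟩⟩ := hN (K + 3) u hu
  have hdd : (d : ℝ) * d = 1 := by rcases hd with rfl | rfl <;> norm_num
  obtain ⟨s, hs, t, ht, hst, w', hw'⟩ := w.exists_exit {x : ℝ × ℝ | (d : ℝ) * x.1 ≤ m} hum (by
    simp only [Set.mem_ofPred_eq, Prod.fst_add, not_le, mul_add]
    have : (d : ℝ) * (((K + 3 : ℕ) : ℝ) * d) = K + 3 := by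
      push_cast
      linear_combination (K + 3 : ℝ) * hdd
    rw [this]
    linarith)
  simp only [Set.mem_ofPred_eq, not_le] at hs ht hw'
  have hbox : ∀ e ∈ F, ∀ x ∈ (e : Sym2 (ℝ × ℝ)), d * x.1 ≤ m → e ∈ L.box m := by
    intro e he x hx hxm
    obtain ⟨h1, h2, -⟩ := hF2 e he x hx
    rw [abs_le] at h1 hu2
    refine mem_box.2 ⟨x, hx, ?_, ?_, ?_⟩
    · rcases hd with rfl | rfl <;> push_cast at * <;> constructor <;> linarith
    · linarith
    · linarith
  obtain ⟨e, he, hest⟩ := openGraph_adj.1 hst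
  have heF : e ∈ F := he
  have hsm : s ∈ (e : Sym2 (ℝ × ℝ)) := by simp [hest]
  -- Beyond the side the path may leave the box; only the part up to the first edge crossing the
  -- side is needed.
  refine ⟨F.filter (· ∈ L.box m), fun _ h => (Finset.mem_filter.1 h).2,
    (Finset.card_filter_le _ _).trans hF1, s, t, e,
    Finset.mem_filter.2 ⟨heF, hbox e heF s hsm hs⟩, hest, ?_, ?_⟩
  · have h := reachable_of_mem_support (B := (L.box m : Set L.Edge)) w'
      (fun e he x hx hxw => hbox e he x hx (hw' x hxw)) w'.end_mem_support
    refine h.mono (openGraph_mono fun f hf => ?_)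
    simpa using hf
  · have hadj := adj_of_openGraph_adj hst
    obtain ⟨hc, -, hsa, hta⟩ := arc_isPreconnected hadj
    -- By the intermediate value theorem the drawing of the exit edge meets the line carrying the
    -- side.
    have himg : IsPreconnected ((fun x : ℝ × ℝ => d * x.1) '' L.arc s(s, t)) :=
      hc.image _ (by fun_prop)
    obtain ⟨x, hx, hxm⟩ := himg.Icc_subset (Set.mem_image_of_mem _ hsa)
      (Set.mem_image_of_mem _ hta) ⟨hs, ht.le⟩
    rw [hest]
    have hxs := (hR s t hadj x hx).trans hR'
    rw [Prod.norm_def, max_le_iff, Real.norm_eq_abs, Real.norm_eq_abs, abs_le, abs_le] at hxs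
    have h1 := (hF2 e heF s hsm).1
    rw [abs_le] at h1 hu2
    simp only [Prod.fst_sub, Prod.snd_sub] at hxs
    refine ⟨x, hx, ?_, ?_, ?_⟩
    · rw [Set.mem_singleton_iff]
      simp only at hxm
      linear_combination (d : ℝ) * hxm - x.1 * hdd
    · linarith [hxs.2.1, hxs.2.2]
    · linarith [hxs.2.1, hxs.2.2]

theorem coe_box (m : ℕ) : (L.box m : Set L.Edge) = L.rectEdges (-m) m (-m) m := by
  simp [box]

/-- Crossings between given vertices close to the two sides have exponentially small
probability. -/
theorem exists_connIn_le (L : PlanarLattice) (hp : p ∈ Set.Icc (0 : ℝ) 1) (hp0 : p ≠ 0)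
    (hq : 1 ≤ q) (h : L.SubCrit p q) : ∃ c > 0, ∃ K₀ : ℕ, ∀ K ≥ K₀, ∃ C : ℝ, 0 < C ∧ ∀ m : ℕ,
      2 * K + 2 ≤ m → ∀ u ∈ L.graph.support, ∀ v ∈ L.graph.support,
      (-m : ℝ) ≤ u.1 → u.1 ≤ -((m : ℝ) - K - 2) → |u.2| ≤ (m : ℝ) - K + 1 →
      v.1 ≤ m → (m : ℝ) - K - 2 ≤ v.1 → |v.2| ≤ (m : ℝ) - K + 1 →
      rcProb (wired (L.box (2 * m))) p q (connIn (L.box m) u v) ≤ C * Real.exp (-(c * m)) := by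
  classical
  obtain ⟨c, hc, hcross⟩ := h
  obtain ⟨K₁, hK₁⟩ := exists_extension L (-1) (Or.inr rfl)
  obtain ⟨K₂, hK₂⟩ := exists_extension L 1 (Or.inl rfl)
  have hpos : 0 < p := lt_of_le_of_ne hp.1 (Ne.symm hp0)
  have hq0 : 0 < q := zero_lt_one.trans_le hq
  have hpq : 0 < p / q := div_pos hpos hq0
  have hpq1 : p / q ≤ 1 := (div_le_one hq0).2 (hp.2.trans hq)
  refine ⟨c, hc, max K₁ K₂, fun K hK => ?_⟩
  obtain ⟨N₁, hN₁⟩ := hK₁ K ((le_max_left _ _).trans hK)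
  obtain ⟨N₂, hN₂⟩ := hK₂ K ((le_max_right _ _).trans hK)
  -- The inverse of the cost of opening both extensions.
  refine ⟨((p / q) ^ (N₁ + N₂))⁻¹, by positivity, ?_⟩
  intro m hm u hu v hv hu1 hu2 hu3 hv1 hv2 hv3
  obtain ⟨F₁, hF₁, hc₁, s₁, t₁, e₁, he₁, hst₁, hr₁, ha₁⟩ := hN₁ m hm u hu
    (by push_cast; linarith) (by push_cast; linarith) hu3
  obtain ⟨F₂, hF₂, hc₂, s₂, t₂, e₂, he₂, hst₂, hr₂, ha₂⟩ := hN₂ m hm v hv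
    (by push_cast; linarith) (by push_cast; linarith) hv3
  have hbb : L.box m ⊆ L.box (2 * m) := box_mono (by omega)
  have hFU : F₁ ∪ F₂ ⊆ L.box (2 * m) := Finset.union_subset (hF₁.trans hbb) (hF₂.trans hbb)
  have key := pow_mul_rcProb_le hp hq hFU (isUpperSet_connIn (L.box m) u v)
    (B := L.horizontalCrossing (-m) m (-m) m) ?_
  · have h1 : (p / q) ^ (N₁ + N₂) ≤ (p / q) ^ (F₁ ∪ F₂).card :=
      pow_le_pow_of_le_one hpq.le hpq1 ((Finset.card_union_le _ _).trans (add_le_add hc₁ hc₂))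
    have h2 := hcross m (by omega)
    rw [← div_eq_inv_mul, le_div_iff₀ (by positivity), mul_comm]
    exact (mul_le_mul_of_nonneg_right h1 (rcProb_nonneg hp hq _ _)).trans (key.trans h2)
  · intro ω hω hFω
    have hω' : (openGraph (ω ∩ L.rectEdges (-m) m (-m) m)).Reachable u v := by
      rw [← coe_box]
      exact hω
    have hsub : ∀ f, (f ∈ F₁ ∨ f ∈ F₂) → f ∈ ω ∩ L.rectEdges (-m) m (-m) m := by
      intro f hf
      rw [← coe_box]
      exact ⟨hFω (by simpa using hf), hf.elim (fun h => hF₁ h) (fun h => hF₂ h)⟩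
    obtain ⟨w⟩ := ((hr₁.mono (openGraph_mono fun f hf => hsub f (Or.inl hf))).symm.trans
      hω').trans (hr₂.mono (openGraph_mono fun f hf => hsub f (Or.inr hf)))
    have hadj₁ : (openGraph (ω ∩ L.rectEdges (-m) m (-m) m)).Adj t₁ s₁ :=
      openGraph_adj.2 ⟨e₁, hsub e₁ (Or.inl he₁), by rw [hst₁, Sym2.eq_swap]⟩
    have hadj₂ : (openGraph (ω ∩ L.rectEdges (-m) m (-m) m)).Adj s₂ t₂ :=
      openGraph_adj.2 ⟨e₂, hsub e₂ (Or.inr he₂), hst₂⟩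
    -- The walk includes the exit edges themselves, whose drawings meet the sides.
    refine ⟨t₁, t₂, SimpleGraph.Walk.cons hadj₁ (w.append
      (SimpleGraph.Walk.cons hadj₂ SimpleGraph.Walk.nil)), ⟨e₁, ?_, ?_⟩, ⟨e₂, ?_, ?_⟩⟩
    · simp [hst₁, Sym2.eq_swap]
    · simpa using ha₁
    · simp [hst₂]
    · simpa using ha₂

end PlanarLattice

/-! ### Extreme values of `p` and strict bounds. -/

namespace PlanarLattice

variable {L : PlanarLattice} {p q : ℝ}

theorem rcProb_eq_one_of_p_eq_one (hq : 1 ≤ q) {E : Finset L.Edge} (ξ : BoundaryCondition E)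
    {A : Set L.Config} (hA : (E : Set L.Edge) ∈ A) : rcProb ξ 1 q A = 1 := by
  classical
  rw [rcProb_eq_wsum, div_eq_one_iff_eq (wsum_univ_pos (by simp) hq ξ).ne', wsum_univ,
    wsum_eq_sum_ite]
  refine Finset.sum_congr rfl fun ω hω => ?_
  rcases eq_or_ne ω E with rfl | h
  · rw [if_pos hA]
  · have hlt := Finset.card_lt_card ((Finset.mem_powerset.1 hω).ssubset_of_ne h)
    have : weight ξ 1 q ω = 0 := by
      rw [weight, sub_self, zero_pow (by omega)]
      simp
    rw [this, ite_self]

theorem rcProb_eq_zero_of_p_eq_zero {E : Finset L.Edge} (ξ : BoundaryCondition E)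
    {A : Set L.Config} (hA : ∅ ∉ A) : rcProb ξ 0 q A = 0 := by
  classical
  rw [rcProb_eq_wsum, wsum_eq_sum_ite, Finset.sum_eq_zero, zero_div]
  intro ω _
  rcases ω.eq_empty_or_nonempty with rfl | h
  · simp [hA]
  · simp [weight, h.card_pos.ne']

/-- The empty configuration has positive weight and is missing from `A`. -/
theorem rcProb_lt_one (hp : p ∈ Set.Icc (0 : ℝ) 1) (hp1 : p ≠ 1) (hq : 1 ≤ q)
    {E : Finset L.Edge} (ξ : BoundaryCondition E) {A : Set L.Config} (hA : ∅ ∉ A) :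
    rcProb ξ p q A < 1 := by
  classical
  rw [rcProb_eq_wsum, div_lt_one (wsum_univ_pos hp hq ξ), wsum_univ, wsum_eq_sum_ite]
  have hq0 : 0 < q := zero_lt_one.trans_le hq
  have hp' : 0 < 1 - p := sub_pos.2 (lt_of_le_of_ne hp.2 hp1)
  refine Finset.sum_lt_sum (fun ω _ => ?_) ⟨∅, by simp, ?_⟩
  · have := weight_nonneg hp hq ξ ω
    split_ifs <;> simp [this]
  · rw [if_neg (by simpa using hA)]
    simp only [weight, Finset.card_empty, pow_zero, one_mul]
    positivity

theorem empty_notMem_toBoundary {E : Finset L.Edge} {v : ℝ × ℝ} (hv : v ∉ boundary E) :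
    ∅ ∉ toBoundary E v := by
  rintro ⟨b, hb, ⟨w⟩⟩
  cases w with
  | nil => exact hv hb
  | cons h _ =>
    obtain ⟨e, he, -⟩ := openGraph_adj.1 h
    exact he

theorem norm_gt_of_mem_boundary {n : ℕ} {v : ℝ × ℝ} (hv : v ∈ boundary (L.box n)) :
    (n : ℝ) < ‖v‖ := by
  obtain ⟨-, e, he, hve⟩ := hv
  by_contra h
  exact he (mem_box_norm.2 ⟨v, hve, not_lt.1 h⟩)

/-- The subcritical property excludes `p = 1`. -/
theorem SubCrit.ne_one (hq : 1 ≤ q) (h : L.SubCrit p q) : p ≠ 1 := by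
  rintro rfl
  obtain ⟨c, hc, K₀, hK₀⟩ := exists_connIn_le L (by simp) one_ne_zero hq h
  obtain ⟨N, hN⟩ := exists_straight L 1 (Or.inl rfl)
  obtain ⟨C, hC, hbound⟩ := hK₀ (max K₀ N) (le_max_left _ _)
  set K := max K₀ N
  have hKN : (N : ℝ) ≤ K := by exact_mod_cast le_max_right _ _
  -- At `p = 1` every edge is open, so the nearly straight path from `(-(m - K), 0)` to `(m - K, 0)`
  -- inside the box gives a connection of probability one, against the exponential bound.
  have hge : ∀ m : ℕ, 2 * K + 2 ≤ m → 1 ≤ C * Real.exp (-(c * m)) := by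
    intro m hm
    have hm' : 2 * (K : ℝ) + 2 ≤ m := by exact_mod_cast hm
    have hK0 : (0 : ℝ) ≤ K := Nat.cast_nonneg K
    obtain ⟨F, -, hF, hr⟩ := hN (2 * (m - K)) (((-((m : ℤ) - K) : ℤ) : ℝ), ((0 : ℤ) : ℝ))
      (intCast_mem_support _ _)
    have hcast : ((2 * (m - K) : ℕ) : ℝ) = 2 * ((m : ℝ) - K) := by
      push_cast [Nat.cast_sub (show K ≤ m by omega)]
      ring
    have hv : ((((-((m : ℤ) - K) : ℤ) : ℝ), ((0 : ℤ) : ℝ)) : ℝ × ℝ) +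
        (((2 * (m - K) : ℕ) : ℝ) * ((1 : ℤ) : ℝ), 0) =
        ((((m : ℤ) - K : ℤ) : ℝ), ((0 : ℤ) : ℝ)) := by
      rw [hcast]
      ext
      · simp only [Prod.fst_add]
        push_cast
        ring
      · simp
    rw [hv] at hr
    have hFm : F ⊆ L.box m := by
      intro e he
      obtain ⟨w, hw⟩ : ∃ w, w ∈ (e : Sym2 (ℝ × ℝ)) := ⟨_, Sym2.out_fst_mem _⟩
      obtain ⟨h1, h2, h3⟩ := hF e he w hw
      rw [hcast] at h3
      rw [abs_le] at h1
      push_cast at h1 h2 h3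
      exact mem_box.2 ⟨w, hw, ⟨by linarith, by linarith⟩, ⟨by linarith, by linarith⟩⟩
    have hb := hbound m hm _ (intCast_mem_support (-((m : ℤ) - K)) 0) _
      (intCast_mem_support ((m : ℤ) - K) 0) (by push_cast; linarith) (by push_cast; linarith)
      (by simp; linarith) (by push_cast; linarith) (by push_cast; linarith) (by simp; linarith)
    rwa [rcProb_eq_one_of_p_eq_one hq] at hb
    refine hr.mono (openGraph_mono fun e he => ⟨?_, hFm he⟩)
    exact box_mono (by omega) (hFm he)
  have hlim : Tendsto (fun m : ℕ => C * Real.exp (-(c * m))) atTop (𝓝 0) := by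
    rw [← mul_zero C]
    refine tendsto_const_nhds.mul (Real.tendsto_exp_neg_atTop_nhds_zero.comp ?_)
    exact tendsto_natCast_atTop_atTop.const_mul_atTop hc
  have := ge_of_tendsto hlim ((eventually_ge_atTop (2 * K + 2)).mono hge)
  linarith

/-! ### From a long arm to a crossed square. -/

/-- The pairs of vertices close to opposite vertical sides of the box of size `m`. -/
def IsCrossingPair (L : PlanarLattice) (K m : ℕ) (u v : ℝ × ℝ) : Prop :=
  u ∈ L.graph.support ∧ v ∈ L.graph.support ∧
    (-m : ℝ) ≤ u.1 ∧ u.1 ≤ -((m : ℝ) - K - 2) ∧ |u.2| ≤ (m : ℝ) - K + 1 ∧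
    v.1 ≤ m ∧ (m : ℝ) - K - 2 ≤ v.1 ∧ |v.2| ≤ (m : ℝ) - K + 1

/-- Wiring closer, around the translated box of size `2 * m`, only raises the probability; a
translation, and a rotation for vertical pairs, then bring the event to the centred box. -/
theorem rcProb_connIn_boxAt_le (hp : p ∈ Set.Icc (0 : ℝ) 1) (hq : 1 ≤ q) {K m : ℕ} {B : ℝ}
    (hB : ∀ u v, L.IsCrossingPair K m u v →
      rcProb (wired (L.box (2 * m))) p q (connIn (L.box m) u v) ≤ B)
    {z : ℤ × ℤ} {E : Finset L.Edge} (hE : L.boxAt z (2 * m) ⊆ E) {u v : ℝ × ℝ}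
    (huv : L.IsCrossingPair K m ((L.translateIso z).symm u) ((L.translateIso z).symm v) ∨
      L.IsCrossingPair K m (L.rotateIso.symm ((L.translateIso z).symm u))
        (L.rotateIso.symm ((L.translateIso z).symm v))) :
    rcProb (wired E) p q (connIn (L.boxAt z m) u v) ≤ B := by
  have hsub : L.boxAt z m ⊆ L.boxAt z (2 * m) := Finset.map_subset_map.2 (box_mono (by omega))
  have hne : (L.boxAt z (2 * m)).Nonempty := (box_nonempty (2 * m)).map
  refine (rcProb_wired_anti hp hq hE hne (isUpperSet_connIn _ _ _)
    (dependsOnEdges_connIn hsub u v)).trans ?_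
  have h1 := rcProb_connIn_mapEdges (p := p) (q := q) (L.translateIso z) (L.box (2 * m)) (L.box m)
    ((L.translateIso z).symm u) ((L.translateIso z).symm v)
  rw [RelIso.apply_symm_apply, RelIso.apply_symm_apply] at h1
  rw [boxAt, boxAt, h1]
  rcases huv with h | h
  · exact hB _ _ h
  · have h2 := rcProb_connIn_mapEdges (p := p) (q := q) L.rotateIso (L.box (2 * m)) (L.box m)
      (L.rotateIso.symm ((L.translateIso z).symm u)) (L.rotateIso.symm ((L.translateIso z).symm v))
    rw [RelIso.apply_symm_apply, RelIso.apply_symm_apply, mapEdges_rotate_box,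
      mapEdges_rotate_box] at h2
    rw [h2]
    exact hB _ _ h

/-- A rectangle which is wider than high fits into a square with integer centre, whose vertical
sides are close to those of the rectangle. -/
theorem exists_square {K : ℕ} (hK : 1 ≤ K) {k r X₁ X₂ Y₁ Y₂ : ℝ} (hX : k < X₂ - X₁)
    (hk : 0 ≤ k) (hY : Y₁ ≤ Y₂) (hXY : Y₂ - Y₁ ≤ X₂ - X₁) (h1 : -r ≤ X₁) (h2 : X₂ ≤ r) (h3 : -r ≤ Y₁)
    (h4 : Y₂ ≤ r) : ∃ (z₁ z₂ : ℤ) (m : ℕ), k / 2 ≤ m ∧ (m : ℝ) ≤ r + K + 1 ∧ |(z₁ : ℝ)| ≤ r + 1 ∧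
      |(z₂ : ℝ)| ≤ r + 1 ∧ (-m : ℝ) ≤ X₁ - z₁ ∧ X₁ - z₁ ≤ -((m : ℝ) - K - 2) ∧ X₂ - z₁ ≤ m ∧
      (m : ℝ) - K - 2 ≤ X₂ - z₁ ∧ ∀ y, Y₁ ≤ y → y ≤ Y₂ → |y - z₂| ≤ (m : ℝ) - K + 1 := by
  have hz₁ := abs_le.1 (abs_sub_round ((X₁ + X₂) / 2))
  have hz₂ := abs_le.1 (abs_sub_round ((Y₁ + Y₂) / 2))
  have hm₁ := Nat.le_ceil ((X₂ - X₁) / 2)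
  have hm₂ := Nat.ceil_lt_add_one (show 0 ≤ (X₂ - X₁) / 2 by linarith)
  have hK' : (1 : ℝ) ≤ K := by exact_mod_cast hK
  -- Rounding moves the centre by at most `1 / 2` and enlarges the half-width by less than `1`; the
  -- added `K` leaves room for the extensions above and below the path.
  refine ⟨round ((X₁ + X₂) / 2), round ((Y₁ + Y₂) / 2), ⌈(X₂ - X₁) / 2⌉₊ + K, ?_, ?_, ?_, ?_, ?_,
    ?_, ?_, ?_, fun y hy1 hy2 => ?_⟩
  all_goals try rw [abs_le]
  all_goals try push_cast
  all_goals try constructor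
  all_goals linarith [hz₁.1, hz₁.2, hz₂.1, hz₂.2]

theorem support_subset_of_walk {ω : L.Config} {a b : ℝ × ℝ} (w : (openGraph ω).Walk a b)
    (ha : a ∈ L.graph.support) : ∀ x ∈ w.support, x ∈ L.graph.support := by
  induction w with
  | nil => simpa using ha
  | cons h _ ih =>
    have hadj := adj_of_openGraph_adj h
    intro x hx
    rw [SimpleGraph.Walk.support_cons, List.mem_cons] at hx
    rcases hx with rfl | hx
    exacts [ha, ih ⟨_, hadj.symm⟩ x hx]

theorem mem_support_iso (σ : L.graph ≃g L.graph) {u : ℝ × ℝ} (hu : u ∈ L.graph.support) :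
    σ u ∈ L.graph.support := by
  obtain ⟨w, hw⟩ := hu
  exact ⟨σ w, σ.map_rel_iff.2 hw⟩

/-- If `0` is connected to the boundary of a large box, then some smaller square of comparable size
is crossed in one of the two directions. -/
theorem exists_crossing_of_toBoundary (L : PlanarLattice) {K : ℕ} (hK : 1 ≤ K) :
    ∃ n₀ : ℕ, ∀ n ≥ n₀, ∀ ω ∈ toBoundary (L.box n) 0, ∃ (z : ℤ × ℤ) (m : ℕ) (u v : ℝ × ℝ),
      |(z.1 : ℝ)| ≤ n ∧ |(z.2 : ℝ)| ≤ n ∧ m ≤ n ∧ n ≤ 20 * m ∧ 2 * K + 2 ≤ m ∧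
      L.boxAt z (2 * m) ⊆ L.box n ∧ u ∈ L.graph.support ∧ ‖u‖ ≤ n ∧ v ∈ L.graph.support ∧
      ‖v‖ ≤ n ∧ ω ∈ connIn (L.boxAt z m) u v ∧
      (L.IsCrossingPair K m ((L.translateIso z).symm u) ((L.translateIso z).symm v) ∨
      L.IsCrossingPair K m (L.rotateIso.symm ((L.translateIso z).symm u))
        (L.rotateIso.symm ((L.translateIso z).symm v))) := by
  classical
  obtain ⟨R₀, hR₀0, hR₀⟩ := exists_arc_bound L
  obtain ⟨R, hR⟩ := exists_nat_ge R₀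
  refine ⟨24 * R + 32 * K + 80, fun n hn ω hω => ?_⟩
  obtain ⟨b, hb, hb0⟩ := hω
  obtain ⟨w⟩ := hb0.symm
  -- The doubled square reaches out to about `3 * k`, so it stays in the box of size `n`, while `m ≥
  -- k / 2` remains comparable to `n`.
  set k : ℕ := n / 8 with hk
  have hk1 : 8 * (k : ℝ) ≤ n := by exact_mod_cast (by omega : 8 * k ≤ n)
  have hk2 : (n : ℝ) ≤ 8 * k + 7 := by exact_mod_cast (by omega : n ≤ 8 * k + 7)
  have hn' : 24 * (R : ℝ) + 32 * K + 80 ≤ n := by exact_mod_cast hn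
  have hK' : (1 : ℝ) ≤ K := by exact_mod_cast hK
  have hR0 : (0 : ℝ) ≤ R := Nat.cast_nonneg R
  have hbn := norm_gt_of_mem_boundary hb
  obtain ⟨s, hs, t, ht, hst, w', hw'⟩ := w.exists_exit {x : ℝ × ℝ | ‖x‖ ≤ (k : ℝ)}
    (by simp) (by
      simp only [Set.mem_ofPred_eq, not_le]
      linarith)
  simp only [Set.mem_ofPred_eq, not_le] at hs ht hw'
  have htR : ‖t‖ ≤ k + R := by
    have hadj := adj_of_openGraph_adj hst
    have := hR₀ s t hadj t (arc_isPreconnected hadj).2.2.2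
    calc ‖t‖ = ‖s + (t - s)‖ := by rw [add_sub_cancel]
      _ ≤ ‖s‖ + ‖t - s‖ := norm_add_le _ _
      _ ≤ k + R := add_le_add hs (this.trans hR)
  -- Keeping the exit edge gives a vertex of norm greater than `k`, while all norms stay at most `k
  -- + R`.
  set P := w'.concat hst with hP
  have hPr : ∀ x ∈ P.support, ‖x‖ ≤ (k : ℝ) + R := by
    intro x hx
    rw [hP, SimpleGraph.Walk.support_concat, List.mem_append,
      List.mem_singleton] at hx
    rcases hx with hx | rfl
    · exact (hw' x hx).trans (by linarith)
    · exact htR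
  have hPr' : ∀ x ∈ P.support, (-((k : ℝ) + R) ≤ x.1 ∧ x.1 ≤ (k : ℝ) + R) ∧
      (-((k : ℝ) + R) ≤ x.2 ∧ x.2 ≤ (k : ℝ) + R) := by
    intro x hx
    have := hPr x hx
    rwa [Prod.norm_def, max_le_iff, Real.norm_eq_abs, Real.norm_eq_abs, abs_le, abs_le] at this
  have hPs := support_subset_of_walk P L.zero_mem
  have h0P : (0 : ℝ × ℝ) ∈ P.support := P.start_mem_support
  have htP : t ∈ P.support := P.end_mem_support
  have hne : P.support.toFinset.Nonempty := ⟨0, List.mem_toFinset.2 h0P⟩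
  obtain ⟨u, hu, hu'⟩ := Finset.exists_min_image P.support.toFinset Prod.fst hne
  obtain ⟨v, hv, hv'⟩ := Finset.exists_max_image P.support.toFinset Prod.fst hne
  obtain ⟨u₂, hu₂, hu₂'⟩ := Finset.exists_min_image P.support.toFinset Prod.snd hne
  obtain ⟨v₂, hv₂, hv₂'⟩ := Finset.exists_max_image P.support.toFinset Prod.snd hne
  simp only [List.mem_toFinset] at hu hu' hv hv' hu₂ hu₂' hv₂ hv₂'
  have hconn : ∀ (z : ℤ × ℤ) (m : ℕ), (∀ x ∈ P.support, |x.1 - z.1| ≤ m ∧ |x.2 - z.2| ≤ m) →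
      ∀ x ∈ P.support, ∀ y ∈ P.support, ω ∈ connIn (L.boxAt z m) x y := by
    intro z m hz x hx y hy
    have hB : ∀ e ∈ ω, ∀ x ∈ (e : Sym2 (ℝ × ℝ)), x ∈ P.support →
        e ∈ (L.boxAt z m : Set L.Edge) := by
      intro e _ x hxe hx
      refine mem_boxAt.2 ⟨x, hxe, ?_⟩
      rw [Prod.norm_def, max_le_iff, Real.norm_eq_abs, Real.norm_eq_abs]
      exact hz x hx
    exact (reachable_of_mem_support P hB hx).symm.trans (reachable_of_mem_support P hB hy)
  have hbox : ∀ (z : ℤ × ℤ) (m : ℕ), |(z.1 : ℝ)| ≤ k + R + 1 → |(z.2 : ℝ)| ≤ k + R + 1 →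
      (m : ℝ) ≤ k + R + K + 1 → L.boxAt z (2 * m) ⊆ L.box n := by
    intro z m h1 h2 hm e he
    obtain ⟨x, hx, hxz⟩ := mem_boxAt.1 he
    refine mem_box_norm.2 ⟨x, hx, ?_⟩
    have hz : ‖((z.1 : ℝ), (z.2 : ℝ))‖ ≤ k + R + 1 := by
      rw [Prod.norm_def, max_le_iff]
      exact ⟨h1, h2⟩
    have := norm_add_le (x - ((z.1 : ℝ), (z.2 : ℝ))) ((z.1 : ℝ), (z.2 : ℝ))
    rw [sub_add_cancel] at this
    push_cast at hxz
    linarith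
  have h20 : ∀ m : ℕ, (k : ℝ) / 2 ≤ m → n ≤ 20 * m ∧ 2 * K + 2 ≤ m := by
    intro m hm
    constructor
    · have : (n : ℝ) ≤ 20 * m := by linarith
      exact_mod_cast this
    · have : 2 * (K : ℝ) + 2 ≤ m := by linarith
      exact_mod_cast this
  have hk0 : (0 : ℝ) ≤ k := Nat.cast_nonneg k
  have hmn : ∀ m : ℕ, (m : ℝ) ≤ k + R + K + 1 → m ≤ n := by
    intro m hm
    have : (m : ℝ) ≤ n := by linarith
    exact_mod_cast this
  rw [Prod.norm_def, lt_max_iff, Real.norm_eq_abs, Real.norm_eq_abs, lt_abs, lt_abs] at ht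
  have h0u := hu' 0 h0P
  have h0v := hv' 0 h0P
  have h0u₂ := hu₂' 0 h0P
  have h0v₂ := hv₂' 0 h0P
  simp only [Prod.fst_zero, Prod.snd_zero] at h0u h0v h0u₂ h0v₂
  have htu := hu' t htP
  have htv := hv' t htP
  have htu₂ := hu₂' t htP
  have htv₂ := hv₂' t htP
  -- The path contains `0` and `t`, so its bounding rectangle has a side longer than `k`.
  have hmax : (k : ℝ) < v.1 - u.1 ∨ (k : ℝ) < v₂.2 - u₂.2 := by
    rcases ht with (h | h) | (h | h)
    · left; linarith
    · left; linarith
    · right; linarith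
    · right; linarith
  rcases le_total (v₂.2 - u₂.2) (v.1 - u.1) with hWH | hWH
  · have hW : (k : ℝ) < v.1 - u.1 := hmax.elim id (fun h => h.trans_le hWH)
    obtain ⟨z₁, z₂, m, hm1, hm2, hz1, hz2, hu1, hu2, hv1, hv2, hy⟩ :=
      exists_square hK hW hk0 (h0u₂.trans h0v₂) hWH (hPr' u hu).1.1 (hPr' v hv).1.2
        (hPr' u₂ hu₂).2.1 (hPr' v₂ hv₂).2.2
    have hyP : ∀ x ∈ P.support, |x.2 - z₂| ≤ (m : ℝ) - K + 1 := fun x hx =>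
      hy _ (hu₂' x hx) (hv₂' x hx)
    refine ⟨(z₁, z₂), m, u, v, by linarith, by linarith, hmn m hm2, (h20 m hm1).1, (h20 m hm1).2,
      hbox _ m hz1 hz2 hm2, hPs u hu, (hPr u hu).trans (by linarith), hPs v hv,
      (hPr v hv).trans (by linarith), hconn _ m (fun x hx => ⟨?_, ?_⟩) u hu v hv, Or.inl ?_⟩
    · rw [abs_le]
      exact ⟨by linarith [hu' x hx], by linarith [hv' x hx]⟩
    · exact (hyP x hx).trans (by linarith)
    · refine ⟨mem_support_iso _ (hPs u hu), mem_support_iso _ (hPs v hv), ?_⟩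
      change (-m : ℝ) ≤ u.1 + -(z₁ : ℝ) ∧ u.1 + -(z₁ : ℝ) ≤ _ ∧ |u.2 + -(z₂ : ℝ)| ≤ _ ∧
        v.1 + -(z₁ : ℝ) ≤ _ ∧ _ ≤ v.1 + -(z₁ : ℝ) ∧ |v.2 + -(z₂ : ℝ)| ≤ _
      simp only [← sub_eq_add_neg]
      exact ⟨hu1, hu2, hyP u hu, hv1, hv2, hyP v hv⟩
  · have hW : (k : ℝ) < v₂.2 - u₂.2 := hmax.elim (fun h => h.trans_le hWH) id
    -- The same with the coordinates exchanged; the inverse rotation makes the pair horizontal.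
    obtain ⟨z₂, z₁, m, hm1, hm2, hz2, hz1, hu1, hu2, hv1, hv2, hy⟩ :=
      exists_square hK hW hk0 (h0u.trans h0v) hWH (hPr' u₂ hu₂).2.1 (hPr' v₂ hv₂).2.2
        (hPr' u hu).1.1 (hPr' v hv).1.2
    have hyP : ∀ x ∈ P.support, |x.1 - z₁| ≤ (m : ℝ) - K + 1 := fun x hx =>
      hy _ (hu' x hx) (hv' x hx)
    refine ⟨(z₁, z₂), m, u₂, v₂, by linarith, by linarith, hmn m hm2, (h20 m hm1).1,
      (h20 m hm1).2, hbox _ m hz1 hz2 hm2, hPs u₂ hu₂, (hPr u₂ hu₂).trans (by linarith), hPs v₂ hv₂,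
      (hPr v₂ hv₂).trans (by linarith), hconn _ m (fun x hx => ⟨?_, ?_⟩) u₂ hu₂ v₂ hv₂, Or.inr ?_⟩
    · exact (hyP x hx).trans (by linarith)
    · rw [abs_le]
      exact ⟨by linarith [hu₂' x hx], by linarith [hv₂' x hx]⟩
    · refine ⟨mem_support_iso _ (mem_support_iso _ (hPs u₂ hu₂)),
        mem_support_iso _ (mem_support_iso _ (hPs v₂ hv₂)), ?_⟩
      change (-m : ℝ) ≤ u₂.2 + -(z₂ : ℝ) ∧ u₂.2 + -(z₂ : ℝ) ≤ _ ∧ |-(u₂.1 + -(z₁ : ℝ))| ≤ _ ∧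
        v₂.2 + -(z₂ : ℝ) ≤ _ ∧ _ ≤ v₂.2 + -(z₂ : ℝ) ∧ |-(v₂.1 + -(z₁ : ℝ))| ≤ _
      simp only [← sub_eq_add_neg, abs_neg]
      exact ⟨hu1, hu2, hyP u₂ hu₂, hv1, hv2, hyP v₂ hv₂⟩

end PlanarLattice

/-! ### Union bound and exponential decay. -/

namespace PlanarLattice

variable {L : PlanarLattice} {p q : ℝ}

theorem finite_ball (L : PlanarLattice) (n : ℕ) :
    (Metric.closedBall (0 : ℝ × ℝ) n ∩ L.graph.support).Finite :=
  L.finite_vertices _ Metric.isBounded_closedBall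

/-- The number of vertices of a box is at most quadratic in its size. -/
theorem exists_card_ball_le (L : PlanarLattice) :
    ∃ M : ℕ, ∀ n : ℕ, (L.finite_ball n).toFinset.card ≤ M * (2 * n + 3) ^ 2 := by
  classical
  refine ⟨(finite_cell L).toFinset.card, fun n => ?_⟩
  have hsub : (L.finite_ball n).toFinset ⊆ ((finite_cell L).toFinset ×ˢ
      (Finset.Icc (-(n + 1) : ℤ) (n + 1) ×ˢ Finset.Icc (-(n + 1) : ℤ) (n + 1))).image
      (fun x => x.1 + ((x.2.1 : ℝ), (x.2.2 : ℝ))) := by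
    intro u hu
    rw [Set.Finite.mem_toFinset] at hu
    obtain ⟨hun, hus⟩ := hu
    rw [mem_closedBall_zero_iff, Prod.norm_def, max_le_iff, Real.norm_eq_abs, Real.norm_eq_abs,
      abs_le, abs_le] at hun
    have hfl : ∀ x : ℝ, -(n : ℝ) ≤ x ∧ x ≤ n → ⌊x⌋ ∈ Finset.Icc (-(n + 1) : ℤ) (n + 1) := by
      intro x hx
      rw [Finset.mem_Icc]
      constructor
      · rw [Int.le_floor]
        push_cast
        linarith
      · have := Int.floor_le x
        have h : (⌊x⌋ : ℝ) ≤ ((n + 1 : ℤ) : ℝ) := by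
          push_cast
          linarith
        exact_mod_cast h
    refine Finset.mem_image.2 ⟨(u - (((floorPt u).1 : ℝ), ((floorPt u).2 : ℝ)), floorPt u), ?_, ?_⟩
    · refine Finset.mem_product.2 ⟨?_, Finset.mem_product.2 ⟨hfl _ hun.1, hfl _ hun.2⟩⟩
      exact (finite_cell L).mem_toFinset.2 ⟨sub_floorPt_mem u, mem_support_sub _ hus⟩
    · simp
  refine (Finset.card_le_card hsub).trans (Finset.card_image_le.trans ?_)
  rw [Finset.card_product, Finset.card_product, Int.card_Icc, ← sq]
  have : ((n + 1 : ℤ) + 1 - -(n + 1)).toNat = 2 * n + 3 := by omega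
  rw [this]

/-- The exponent `7` counts centres (`2`), sizes (`1`) and pairs of endpoints (`4`); `n ≤ 20 * m`
turns the rate `c` in `m` into `c / 20` in `n`. -/
theorem exists_polynomial_bound (L : PlanarLattice) (hp : p ∈ Set.Icc (0 : ℝ) 1) (hp0 : p ≠ 0)
    (hq : 1 ≤ q) (h : L.SubCrit p q) : ∃ c > 0, ∃ D : ℝ, 0 < D ∧ ∃ n₀ : ℕ, ∀ n ≥ n₀,
      rcProb (wired (L.box n)) p q (toBoundary (L.box n) 0) ≤
        D * (n : ℝ) ^ 7 * Real.exp (-(c * n)) := by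
  classical
  obtain ⟨c, hc, K₀, hK₀⟩ := exists_connIn_le L hp hp0 hq h
  set K := max K₀ 1
  obtain ⟨C, hC, hbound⟩ := hK₀ K (le_max_left _ _)
  obtain ⟨n₀, hn₀⟩ := exists_crossing_of_toBoundary L (K := K) (le_max_right _ _)
  obtain ⟨M, hM⟩ := exists_card_ball_le L
  refine ⟨c / 20, by positivity, ((M : ℝ) ^ 2 + 1) * 5 ^ 7 * C, by positivity, max n₀ 1,
    fun n hn => ?_⟩
  have hn1 : 1 ≤ n := (le_max_right _ _).trans hn
  set V := (L.finite_ball n).toFinset with hV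
  set J := Finset.Icc (-n : ℤ) n with hJ
  let Cond : ((ℤ × ℤ) × ℕ) × ((ℝ × ℝ) × (ℝ × ℝ)) → Prop := fun i =>
    n ≤ 20 * i.1.2 ∧ 2 * K + 2 ≤ i.1.2 ∧ L.boxAt i.1.1 (2 * i.1.2) ⊆ L.box n ∧
    (L.IsCrossingPair K i.1.2 ((L.translateIso i.1.1).symm i.2.1)
        ((L.translateIso i.1.1).symm i.2.2) ∨
      L.IsCrossingPair K i.1.2 (L.rotateIso.symm ((L.translateIso i.1.1).symm i.2.1))
        (L.rotateIso.symm ((L.translateIso i.1.1).symm i.2.2)))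
  set I := (((J ×ˢ J) ×ˢ Finset.range (n + 1)) ×ˢ (V ×ˢ V)).filter Cond with hI
  have hprob : ∀ i ∈ I, rcProb (wired (L.box n)) p q (connIn (L.boxAt i.1.1 i.1.2) i.2.1 i.2.2) ≤
      C * Real.exp (-(c / 20 * n)) := by
    intro i hi
    obtain ⟨h20, hKm, hbox, hpair⟩ := (Finset.mem_filter.1 hi).2
    refine rcProb_connIn_boxAt_le hp hq (fun u v huv => ?_) hbox hpair
    obtain ⟨hu, hv, h1, h2, h3, h4, h5, h6⟩ := huv
    refine (hbound _ hKm u hu v hv h1 h2 h3 h4 h5 h6).trans ?_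
    refine mul_le_mul_of_nonneg_left (Real.exp_le_exp.2 (neg_le_neg ?_)) hC.le
    have : (n : ℝ) ≤ 20 * i.1.2 := by exact_mod_cast h20
    calc c / 20 * n ≤ c / 20 * (20 * i.1.2) := by gcongr
      _ = c * i.1.2 := by ring
  have hcard : (I.card : ℝ) ≤ ((M : ℝ) ^ 2 + 1) * 5 ^ 7 * (n : ℝ) ^ 7 := by
    have h1 : I.card ≤ M ^ 2 * (2 * n + 3) ^ 7 := by
      refine (Finset.card_filter_le _ _).trans ?_
      rw [Finset.card_product, Finset.card_product, Finset.card_product, Finset.card_product,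
        Finset.card_range, hJ, Int.card_Icc]
      have hJc : ((n : ℤ) + 1 - -n).toNat = 2 * n + 1 := by omega
      rw [hJc]
      calc (2 * n + 1) * (2 * n + 1) * (n + 1) * (V.card * V.card)
          ≤ (2 * n + 3) * (2 * n + 3) * (2 * n + 3) *
            ((M * (2 * n + 3) ^ 2) * (M * (2 * n + 3) ^ 2)) := by
            have := hM n
            gcongr <;> omega
        _ = M ^ 2 * (2 * n + 3) ^ 7 := by ring
    have h2 : (2 * n + 3) ^ 7 ≤ (5 * n) ^ 7 := Nat.pow_le_pow_left (by omega) 7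
    have h3 : I.card ≤ (M ^ 2 + 1) * 5 ^ 7 * n ^ 7 :=
      calc I.card ≤ M ^ 2 * (5 * n) ^ 7 := h1.trans (Nat.mul_le_mul_left _ h2)
        _ ≤ (M ^ 2 + 1) * (5 * n) ^ 7 := Nat.mul_le_mul_right _ (Nat.le_succ _)
        _ = _ := by ring
    exact_mod_cast h3
  calc rcProb (wired (L.box n)) p q (toBoundary (L.box n) 0)
      ≤ rcProb (wired (L.box n)) p q (⋃ i ∈ I, connIn (L.boxAt i.1.1 i.1.2) i.2.1 i.2.2) := by
        refine rcProb_mono hp hq _ fun ω _ hω => ?_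
        obtain ⟨z, m, u, v, hz1, hz2, hmn, h20, hKm, hbox, hu, hun, hv, hvn, hconn, hpair⟩ :=
          hn₀ n ((le_max_left _ _).trans hn) _ hω
        have hint : ∀ x : ℤ, |(x : ℝ)| ≤ n → x ∈ J := by
          intro x hx
          rw [abs_le] at hx
          exact Finset.mem_Icc.2 ⟨by exact_mod_cast hx.1, by exact_mod_cast hx.2⟩
        refine Set.mem_biUnion (x := ((z, m), (u, v))) (Finset.mem_coe.2 (Finset.mem_filter.2
          ⟨?_, h20, hKm, hbox, hpair⟩)) hconn
        simp only [Finset.mem_product, Finset.mem_range, hV, Set.Finite.mem_toFinset]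
        exact ⟨⟨⟨hint _ hz1, hint _ hz2⟩, by omega⟩,
          ⟨mem_closedBall_zero_iff.2 hun, hu⟩, ⟨mem_closedBall_zero_iff.2 hvn, hv⟩⟩
    _ ≤ ∑ i ∈ I, rcProb (wired (L.box n)) p q (connIn (L.boxAt i.1.1 i.1.2) i.2.1 i.2.2) :=
        rcProb_biUnion_le hp hq _ _ _
    _ ≤ I.card * (C * Real.exp (-(c / 20 * n))) := by
        rw [← nsmul_eq_mul]
        exact Finset.sum_le_card_nsmul _ _ _ hprob
    _ ≤ ((M : ℝ) ^ 2 + 1) * 5 ^ 7 * (n : ℝ) ^ 7 * (C * Real.exp (-(c / 20 * n))) := by gcongr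
    _ = _ := by ring

/-- A sequence below one which eventually decays exponentially decays exponentially. -/
theorem exists_exp_bound {a : ℕ → ℝ} (h1 : ∀ n, a n < 1) {c : ℝ} (hc : 0 < c) {n₀ : ℕ}
    (h2 : ∀ n ≥ n₀, a n ≤ Real.exp (-(c * n))) :
    ∃ c' > 0, ∀ n : ℕ, 1 ≤ n → a n ≤ Real.exp (-(c' * n)) := by
  have key : ∀ N : ℕ, ∃ c' > 0, ∀ n : ℕ, 1 ≤ n → n < N → a n ≤ Real.exp (-(c' * n)) := by
    intro N
    induction N with
    | zero => exact ⟨1, one_pos, fun n _ h => by omega⟩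
    | succ N ih =>
      obtain ⟨c₁, hc₁, h⟩ := ih
      -- A single value `a N < 1` lies below `exp (-(c' * N))` once `c'` is small; the finitely many
      -- small `n` are treated one at a time.
      have hlim : Tendsto (fun c' : ℝ => Real.exp (-(c' * N))) (𝓝[>] 0) (𝓝 1) := by
        have : Continuous fun c' : ℝ => Real.exp (-(c' * N)) := by fun_prop
        have h0 := this.tendsto 0
        simp only [zero_mul, neg_zero, Real.exp_zero] at h0
        exact h0.mono_left nhdsWithin_le_nhds
      obtain ⟨c₂, hc₂, hc₂'⟩ := ((hlim.eventually (lt_mem_nhds (h1 N))).and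
        self_mem_nhdsWithin).exists
      refine ⟨min c₁ c₂, lt_min hc₁ hc₂', fun n hn hnN => ?_⟩
      rcases Nat.lt_succ_iff_lt_or_eq.1 hnN with h' | rfl
      · refine (h n hn h').trans (Real.exp_le_exp.2 (neg_le_neg ?_))
        gcongr
        exact min_le_left _ _
      · refine hc₂.le.trans (Real.exp_le_exp.2 (neg_le_neg ?_))
        gcongr
        exact min_le_right _ _
  obtain ⟨c₁, hc₁, h⟩ := key n₀
  refine ⟨min c₁ c, lt_min hc₁ hc, fun n hn => ?_⟩
  rcases lt_or_ge n n₀ with h' | h'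
  · refine (h n hn h').trans (Real.exp_le_exp.2 (neg_le_neg ?_))
    gcongr
    exact min_le_left _ _
  · refine (h2 n h').trans (Real.exp_le_exp.2 (neg_le_neg ?_))
    gcongr
    exact min_le_right _ _

theorem zero_notMem_boundary_box (n : ℕ) : (0 : ℝ × ℝ) ∉ boundary (L.box n) := by
  intro h
  have := norm_gt_of_mem_boundary h
  rw [norm_zero] at this
  exact absurd this (not_lt.2 (Nat.cast_nonneg n))

/-- Exponential decay of the probability that `0` is connected to the boundary of a box. -/
theorem exists_exp_decay (hp : p ∈ Set.Icc (0 : ℝ) 1) (hq : 1 ≤ q) (h : L.SubCrit p q) :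
    ∃ c > 0, ∀ n : ℕ, 1 ≤ n →
      rcProb (wired (L.box n)) p q (toBoundary (L.box n) 0) ≤ Real.exp (-(c * n)) := by
  -- Opening edges is impossible at `p = 0`, but then nothing is connected to the boundary.
  rcases eq_or_ne p 0 with rfl | hp0
  · refine ⟨1, one_pos, fun n _ => ?_⟩
    rw [rcProb_eq_zero_of_p_eq_zero _ (empty_notMem_toBoundary (zero_notMem_boundary_box n))]
    exact (Real.exp_pos _).le
  · obtain ⟨c, hc, D, hD, n₀, hbound⟩ := exists_polynomial_bound L hp hp0 hq h
    -- Half of the rate absorbs `n ^ 7`; it is rescaled to use that `x ^ 7 * exp (-x)` tends to `0`.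
    have hlim : Tendsto (fun n : ℕ => D * (2 / c) ^ 7 *
        ((c / 2 * n) ^ 7 * Real.exp (-(c / 2 * n)))) atTop (𝓝 0) := by
      have hcn : Tendsto (fun n : ℕ => c / 2 * (n : ℝ)) atTop atTop :=
        tendsto_natCast_atTop_atTop.const_mul_atTop (by positivity)
      have := ((Real.tendsto_pow_mul_exp_neg_atTop_nhds_zero 7).comp hcn).const_mul
        (D * (2 / c) ^ 7)
      rw [mul_zero] at this
      exact this
    obtain ⟨n₁, hn₁⟩ := eventually_atTop.1 (hlim.eventually (gt_mem_nhds one_pos))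
    refine exists_exp_bound (c := c / 2) (n₀ := max n₀ n₁) (fun n => rcProb_lt_one hp (h.ne_one hq)
      hq _ (empty_notMem_toBoundary (zero_notMem_boundary_box n))) (by positivity) fun n hn => ?_
    refine (hbound n ((le_max_left _ _).trans hn)).trans ?_
    have h1 := hn₁ n ((le_max_right _ _).trans hn)
    have h2 : D * (n : ℝ) ^ 7 * Real.exp (-(c * n)) = D * (2 / c) ^ 7 *
        ((c / 2 * n) ^ 7 * Real.exp (-(c / 2 * n))) * Real.exp (-(c / 2 * n)) := by
      have h3 : Real.exp (-(c * n)) = Real.exp (-(c / 2 * n)) * Real.exp (-(c / 2 * n)) := by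
        rw [← Real.exp_add]
        congr 1
        ring
      have h4 : (2 / c) ^ 7 * (c / 2 * n) ^ 7 = (n : ℝ) ^ 7 := by
        rw [← mul_pow]
        congr 1
        field_simp
      rw [h3, ← h4]
      ring
    rw [h2]
    exact mul_le_of_le_one_left (Real.exp_pos _).le h1.le

theorem tendsto_toBoundary_zero {c : ℝ} (hc : 0 < c) (hp : p ∈ Set.Icc (0 : ℝ) 1) (hq : 1 ≤ q)
    (h : ∀ n : ℕ, 1 ≤ n →
      rcProb (wired (L.box n)) p q (toBoundary (L.box n) 0) ≤ Real.exp (-(c * n))) :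
    Tendsto (fun n => rcProb (wired (L.box n)) p q (toBoundary (L.box n) 0)) atTop (𝓝 0) := by
  refine tendsto_of_tendsto_of_tendsto_of_le_of_le' (h := fun n : ℕ => Real.exp (-(c * n)))
    tendsto_const_nhds ?_ (Eventually.of_forall fun n => rcProb_nonneg hp hq _ _)
    (eventually_atTop.2 ⟨1, h⟩)
  exact Real.tendsto_exp_neg_atTop_nhds_zero.comp
    (tendsto_natCast_atTop_atTop.const_mul_atTop hc)

/-- For `p > 0`, opening a fixed path from `v` to `0` costs a factor independent of `n`, so the
decay at `0` passes to `v`. -/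
theorem tendsto_toBoundary (hp : p ∈ Set.Icc (0 : ℝ) 1) (hq : 1 ≤ q)
    (h : Tendsto (fun n => rcProb (wired (L.box n)) p q (toBoundary (L.box n) 0)) atTop (𝓝 0))
    {v : ℝ × ℝ} (hv : v ∈ L.graph.support) :
    Tendsto (fun n => rcProb (wired (L.box n)) p q (toBoundary (L.box n) v)) atTop (𝓝 0) := by
  rcases eq_or_ne p 0 with rfl | hp0
  · refine tendsto_const_nhds.congr' ?_
    filter_upwards [eventually_ge_atTop ⌈‖v‖⌉₊] with n hn
    rw [rcProb_eq_zero_of_p_eq_zero _ (empty_notMem_toBoundary fun hb => ?_)]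
    exact absurd (norm_gt_of_mem_boundary hb) (not_lt.2 (Nat.ceil_le.1 hn))
  · obtain ⟨F, hF⟩ := exists_edges_of_reachable (L.connected v hv 0 L.zero_mem)
    have hq0 : 0 < q := zero_lt_one.trans_le hq
    have hpos : 0 < p := lt_of_le_of_ne hp.1 (Ne.symm hp0)
    have hδ : 0 < (p / q) ^ F.card := by positivity
    have h1 := h.const_mul ((p / q) ^ F.card)⁻¹
    rw [mul_zero] at h1
    refine tendsto_of_tendsto_of_tendsto_of_le_of_le' tendsto_const_nhds h1
      (Eventually.of_forall fun n => rcProb_nonneg hp hq _ _) ?_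
    filter_upwards [tendsto_box.eventually (eventually_ge_atTop F)] with n hn
    rw [← div_eq_inv_mul, le_div_iff₀ hδ, mul_comm]
    refine pow_mul_rcProb_le hp hq hn (isUpperSet_toBoundary _ _) ?_
    rintro ω ⟨b, hb, hbv⟩ hFω
    exact ⟨b, hb, hbv.trans (hF.mono (openGraph_mono hFω))⟩

end PlanarLattice

theorem mainTheorem7 (L : PlanarLattice) (p q : ℝ) (hp : p ∈ Set.Icc (0 : ℝ) 1) (hq : 1 ≤ q)
    (h : L.SubCrit p q) :
    (∃ c : ℝ, 0 < c ∧ ∀ n : ℕ, 1 ≤ n →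
      PlanarLattice.rcProb (PlanarLattice.wired (L.box n)) p q
        (PlanarLattice.zeroToBoundary (L.box n)) ≤ Real.exp (-(c * n))) ∧
    ∃ φ₀ φ₁ : MeasureTheory.Measure L.Config,
      PlanarLattice.IsInfiniteVolumeMeasure PlanarLattice.free p q φ₀ ∧
      PlanarLattice.IsInfiniteVolumeMeasure PlanarLattice.wired p q φ₁ ∧
      φ₁ L.zeroToInfinity = 0 ∧ φ₀ = φ₁ := by
  obtain ⟨c, hc, hdecay⟩ := PlanarLattice.exists_exp_decay hp hq h
  have hlim := PlanarLattice.tendsto_toBoundary_zero hc hp hq hdecay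
  obtain ⟨φ₀, hφ₀⟩ := PlanarLattice.exists_free_measure (L := L) hp hq
  obtain ⟨φ₁, hφ₁⟩ := PlanarLattice.exists_wired_measure (L := L) hp hq
  refine ⟨⟨c, hc, fun n hn => ?_⟩, φ₀, φ₁, hφ₀, hφ₁,
    PlanarLattice.measure_zeroToInfinity_eq_zero hp hq hlim hφ₁,
    PlanarLattice.eq_of_tendsto_toBoundary hp hq
      (fun v hv => PlanarLattice.tendsto_toBoundary hp hq hlim hv) hφ₀ hφ₁⟩
  rw [← PlanarLattice.toBoundary_zero]
  exact hdecay n hn
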